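/- **Conventions.** Languages are algebraic and have no constant symbols (all function symbols have positive arity). A *logic* $\vdash$ is a substitution-invariant consequence relation on the set $Fm(\vdash)$ of formulas of some language $\mathcal{L}_\vdash$ over some infinite set of variables; it *has theorems* if $\emptyset \vdash \varphi$ for some formula $\varphi$. A *matrix* $\langle A, F\rangle$ is a nonempty algebra $A$ with a subset $F \subseteq A$; it is a *model* of $\vdash$ if whenever $\Gamma \vdash \varphi$, every assignment into $A$ that sends $\Gamma$ into $F$ sends $\varphi$ into $F$. $\Omega^{A}F$ is the largest congruence of $A$ compatible with $F$ (that is, for which $F$ is a union of blocks), and $\mathrm{Mod}^{\equiv}(\vdash)$ is the class of models $\langle A, F\rangle$ of $\vdash$ such that $\bigcap\{\Omega^{A}G : F \subseteq G,\ \langle A, G\rangle \text{ a model of } \vdash\}$ is the identity relation. A *translation* $\tau$ of $\mathcal{L}$ into $\mathcal{L}'$ sends each $n$-ary symbol of $\mathcal{L}$ to an $\mathcal{L}'$-formula in the variables $x_1,\dots,x_n$, and turns each $\mathcal{L}'$-algebra $A$ into an $\mathcal{L}$-algebra $A^{\tau}$ on the same universe. We write ${\vdash} \leq {\vdash'}$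 if some translation $\tau$ of $\mathcal{L}_{\vdash}$ into $\mathcal{L}_{\vdash'}$ satisfies $\langle A^{\tau}, F\rangle \in \mathrm{Mod}^{\equiv}(\vdash)$ for all $\langle A, F\rangle \in \mathrm{Mod}^{\equiv}(\vdash')$. A *Leibniz class* is a class of logics of the form $\{\vdash\ : {\vdash_{\alpha}} \leq {\vdash} \text{ for some ordinal } \alpha\}$, where $(\vdash_{\alpha})_{\alpha}$ is a family of logics indexed by all ordinals such that ${\vdash_{\beta}} \leq {\vdash_{\alpha}}$ whenever $\alpha \leq \beta$. Leibniz classes are ordered by inclusion, and $\vee$ denotes suprema in this order. A Leibniz class $K$ is *meet-reducible among logics with theorems* if $K = K_1 \cap K_2$ for some Leibniz classes $K_1, K_2$, both different from $K$ and consisting only of logics with theorems. A logic $\vdash$ is *protoalgebraic* if there is a nonempty set $\Delta(x,y,\vec z)$ of formulas such that for every model $\langle A, F\rangle$ of $\vdash$ and all $a,b \in A$: $\langle a,b\rangle \in \Omega^{A}F$ if and only if $\Delta^{A}(a,b,\vec c) \subseteq F$ for all $\vec c$ in $A$. It is *assertional* if $F$ is a singleton for every $\langle A, F\rangle \in \mathrm{Mod}^{\equiv}(\vdash)$.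 Let $\mathsf{Proto}$ and $\mathsf{Asrt}$ be the classes of protoalgebraic and of assertional logics. Let $\vdash^{\ast}_{\mathsf{BA}}$ be the logic in countably many variables induced by the class of all matrices $\langle A, F\rangle$ with $A$ a Boolean algebra and $F$ any subset of $A$ with $1 \in F$ (the constants $0,1$ being rendered as constant unary operations), and let $\mathrm{Log}(\vdash^{\ast}_{\mathsf{BA}}) = \{\vdash\ : {\vdash^{\ast}_{\mathsf{BA}}} \leq {\vdash}\}$. **Theorem.** The classes $\mathsf{Proto}$, $\mathsf{Asrt}$ and $\mathrm{Log}(\vdash^{\ast}_{\mathsf{BA}})$ are Leibniz classes, and $\mathsf{Proto}$ is meet-reducible among logics with theorems. Moreover, the suprema $\mathsf{Proto} \vee \mathsf{Asrt}$ and $\mathsf{Proto} \vee \mathrm{Log}(\vdash^{\ast}_{\mathsf{BA}})$ exist among Leibniz classes, consist only of logics with theorems, are both strictly larger than $\mathsf{Proto}$, and $$\mathsf{Proto} = (\mathsf{Proto} \vee \mathsf{Asrt}) \cap (\mathsf{Proto} \vee \mathrm{Log}(\vdash^{\ast}_{\mathsf{BA}})).$$ -/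

import Mathlib

universe u

namespace LeibnizHierarchy

open FirstOrder FirstOrder.Language

/-! ### Logics

Sets are modelled by types in a fixed universe `Type u`; classes are `Set`s of large objects. -/

/-- A (propositional) logic: a substitution invariant consequence relation on the set of formulas
(terms) of an algebraic language without constant symbols over an infinite set of variables. -/
structure Logic : Type (u + 1) where
  /-- The language: only function symbols, all of them of positive arity. -/
  lang : FirstOrder.Language.{u, 0}
  algebraic : lang.IsAlgebraic
  noConstants : IsEmpty lang.Constants
  /-- The infinite set of variables. -/
  Var : Type u
  infinite : Infinite Var
  /-- `Entails Γ φ` is `Γ ⊢ φ`. -/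
  Entails : Set (lang.Term Var) → lang.Term Var → Prop
  refl : ∀ Γ φ, φ ∈ Γ → Entails Γ φ
  cut : ∀ Γ Δ φ, (∀ δ ∈ Δ, Entails Γ δ) → Entails Δ φ → Entails Γ φ
  structural : ∀ (σ : Var → lang.Term Var) Γ φ, Entails Γ φ →
    Entails ((fun γ => γ.subst σ) '' Γ) (φ.subst σ)

/-- Formulas of a logic. -/
abbrev Logic.Fm (l : Logic.{u}) : Type u := l.lang.Term l.Var

/-- A logic has theorems when `∅ ⊢ φ` for some formula `φ`. -/
def Logic.HasTheorems (l : Logic.{u}) : Prop := ∃ φ, l.Entails ∅ φ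

/-! ### Matrices -/

/-- A matrix `⟨A, F⟩`: a nonempty algebra `A` together with a subset `F` of its universe. -/
structure LMatrix (L : FirstOrder.Language.{u, 0}) : Type (u + 1) where
  carrier : Type u
  nonempty : Nonempty carrier
  str : L.Structure carrier
  filter : Set carrier

attribute [instance] LMatrix.str

/-- The same algebra with another subset. -/
def LMatrix.withFilter {L : FirstOrder.Language.{u, 0}} (M : LMatrix L) (G : Set M.carrier) : LMatrix L :=
  ⟨M.carrier, M.nonempty, M.str, G⟩

/-- `M` validates the rule `Γ ▷ φ`. -/
def LMatrix.Validates {L : FirstOrder.Language.{u, 0}} (M : LMatrix L) {V : Type u}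
    (Γ : Set (L.Term V)) (φ : L.Term V) : Prop :=
  ∀ v : V → M.carrier, (∀ γ ∈ Γ, γ.realize v ∈ M.filter) → φ.realize v ∈ M.filter

/-- Congruences of the algebra reduct of a matrix. -/
def LMatrix.IsCongruence {L : FirstOrder.Language.{u, 0}} (M : LMatrix L) (θ : Setoid M.carrier) : Prop :=
  ∀ (n : ℕ) (f : L.Functions n) (a b : Fin n → M.carrier),
    (∀ i, θ (a i) (b i)) → θ (Structure.funMap f a) (Structure.funMap f b)

/-- `θ` is compatible with the filter `F` when `F` is a union of `θ`-blocks. -/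
def LMatrix.IsCompatible {L : FirstOrder.Language.{u, 0}} (M : LMatrix L) (θ : Setoid M.carrier) : Prop :=
  ∀ a b, θ a b → a ∈ M.filter → b ∈ M.filter

/-- The Leibniz congruence: the largest congruence compatible with the filter. (The union of all
compatible congruences is itself a compatible congruence.) -/
def LMatrix.Leibniz {L : FirstOrder.Language.{u, 0}} (M : LMatrix L) (a b : M.carrier) : Prop :=
  ∃ θ : Setoid M.carrier, M.IsCongruence θ ∧ M.IsCompatible θ ∧ θ a b

/-- The class of models of a logic. -/
def Mod (l : Logic.{u}) : Set (LMatrix.{u} l.lang) :=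
  {M | ∀ (Γ : Set l.Fm) (φ : l.Fm), l.Entails Γ φ → M.Validates Γ φ}

/-- The Suszko (Tarski) congruence of `⟨A, F⟩` relative to a logic: the intersection of the Leibniz
congruences of `⟨A, G⟩`, for all deductive filters `G` of the logic on `A` that include `F`. -/
def SuszkoCongruence (l : Logic.{u}) (M : LMatrix.{u} l.lang) (a b : M.carrier) : Prop :=
  ∀ G : Set M.carrier, M.filter ⊆ G → M.withFilter G ∈ Mod l → (M.withFilter G).Leibniz a b

/-- The class of models of a logic whose Suszko congruence is the identity relation. -/
def ModSuszko (l : Logic.{u}) : Set (LMatrix.{u} l.lang) :=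
  {M | M ∈ Mod l ∧ ∀ a b, SuszkoCongruence l M a b → a = b}

/-- The logic over the infinite set of variables `V` induced by a class of matrices. -/
def inducedLogic (L : FirstOrder.Language.{u, 0}) (hL : L.IsAlgebraic) (hL₀ : IsEmpty L.Constants)
    (V : Type u) (hV : Infinite V) (K : Set (LMatrix.{u} L)) : Logic.{u} where
  lang := L
  algebraic := hL
  noConstants := hL₀
  Var := V
  infinite := hV
  Entails Γ φ := ∀ M ∈ K, M.Validates Γ φ
  refl _ _ h _ _ _ hv := hv _ h
  cut _ _ _ h₁ h₂ M hM v hv := h₂ M hM v fun δ hδ => h₁ δ hδ M hM v hv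
  structural σ Γ φ h M hM v hv := by
    rw [Term.realize_subst]
    refine h M hM _ fun γ hγ => ?_
    have := hv _ ⟨γ, hγ, rfl⟩
    rwa [Term.realize_subst] at this

/-! ### Interpretations -/

/-- A translation sends each `n`-ary symbol to an `n`-ary formula `φ(x₁, …, xₙ)`. -/
abbrev Translation (L L' : FirstOrder.Language.{u, 0}) : Type u :=
  ∀ n : ℕ, L.Functions n → L'.Term (Fin n)

/-- The matrix `⟨A^τ, F⟩` obtained from `⟨A, F⟩` and a translation `τ`. -/
def LMatrix.translate {L L' : FirstOrder.Language.{u, 0}} (hL : L.IsAlgebraic) (τ : Translation L L')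
    (M : LMatrix.{u} L') : LMatrix.{u} L where
  carrier := M.carrier
  nonempty := M.nonempty
  str :=
    { funMap := fun {n} f a => (τ n f).realize a
      RelMap := fun {n} R _ => (hL n).elim R }
  filter := M.filter

/-- `τ` is an interpretation of `l` into `l'`. -/
def IsInterpretation (l l' : Logic.{u}) (τ : Translation l.lang l'.lang) : Prop :=
  ∀ M ∈ ModSuszko l', M.translate l.algebraic τ ∈ ModSuszko l

/-- `l ≤ l'` when `l` is interpretable into `l'`. -/
instance : LE Logic.{u} := ⟨fun l l' => ∃ τ, IsInterpretation l l' τ⟩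

/-! ### The Leibniz hierarchy -/

/-- `Log(⊢)`: the class of logics in which a given logic is interpretable. -/
def logOf (l : Logic.{u}) : Set Logic.{u} := {l' | l ≤ l'}

/-- A Leibniz condition: a family of logics indexed by all ordinals, weakly decreasing with respect
to interpretability. -/
def IsLeibnizCondition (Φ : Ordinal.{u} → Logic.{u}) : Prop :=
  ∀ α β, α ≤ β → Φ β ≤ Φ α

/-- A Leibniz class is the class `Log(Φ)` of logics satisfying some Leibniz condition `Φ`. -/
def IsLeibnizClass (K : Set Logic.{u}) : Prop :=
  ∃ Φ : Ordinal.{u} → Logic.{u}, IsLeibnizCondition Φ ∧ K = {l | ∃ α, Φ α ≤ l}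

/-- The Leibniz hierarchy: all Leibniz classes, ordered under inclusion. -/
abbrev LeibnizClass : Type (u + 1) := {K : Set Logic.{u} // IsLeibnizClass K}

/-- The class of logics with theorems. -/
def Thrms : Set Logic.{u} := {l | l.HasTheorems}

/-- `K` is meet-reducible among logics with theorems: it is the intersection of two Leibniz classes
of logics with theorems, both different from `K`. -/
def MeetReducibleAmongTheorems (K : LeibnizClass.{u}) : Prop :=
  ∃ K₁ K₂ : LeibnizClass.{u}, K₁.1 ⊆ Thrms ∧ K₂.1 ⊆ Thrms ∧
    K.1 = K₁.1 ∩ K₂.1 ∧ K ≠ K₁ ∧ K ≠ K₂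

/-- A logic is protoalgebraic when it has a nonempty set `Δ(x, y, z⃗)` of congruence formulas with
parameters (the parameters are all variables other than `x` and `y`). -/
def Logic.IsProtoalgebraic (l : Logic.{u}) : Prop :=
  ∃ (x y : l.Var) (Δ : Set l.Fm), x ≠ y ∧ Δ.Nonempty ∧
    ∀ M ∈ Mod l, ∀ a b : M.carrier, M.Leibniz a b ↔
      ∀ v : l.Var → M.carrier, v x = a → v y = b → ∀ δ ∈ Δ, δ.realize v ∈ M.filter

/-- A logic is assertional when `F` is a singleton for each of its Suszko reduced models. -/
def Logic.IsAssertional (l : Logic.{u}) : Prop :=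
  ∀ M ∈ ModSuszko l, ∃ a, M.filter = {a}

/-- The class of protoalgebraic logics. -/
def Proto : Set Logic.{u} := {l | l.IsProtoalgebraic}

/-- The class of assertional logics. -/
def Asrt : Set Logic.{u} := {l | l.IsAssertional}

/-! ### The logic of Boolean algebras with a subset containing `1` -/

/-- Symbols of Boolean algebras; `0` and `1` are unary symbols for constant operations. -/
inductive BoolSymbol : ℕ → Type u
  | inf : BoolSymbol 2
  | sup : BoolSymbol 2
  | compl : BoolSymbol 1
  | bot : BoolSymbol 1
  | top : BoolSymbol 1

/-- The language of Boolean algebras. -/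
def boolLang : FirstOrder.Language.{u, 0} := ⟨BoolSymbol, fun _ => Empty⟩

/-- A Boolean algebra as an algebra in the language `boolLang`. -/
abbrev boolStructure (A : Type u) (_ : BooleanAlgebra A) : boolLang.{u}.Structure A where
  funMap {_} f :=
    match f with
    | .inf => fun a => a 0 ⊓ a 1
    | .sup => fun a => a 0 ⊔ a 1
    | .compl => fun a => (a 0)ᶜ
    | .bot => fun _ => ⊥
    | .top => fun _ => ⊤
  RelMap {_} R := Empty.elim R

/-- The matrices `⟨A, F⟩` with `A` a Boolean algebra and `F` a subset of `A` containing `1`. -/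
def boolMatrices : Set (LMatrix.{u} boolLang.{u}) :=
  {M | ∃ B : BooleanAlgebra M.carrier, M.str = boolStructure M.carrier B ∧ ⊤ ∈ M.filter}

/-- The logic `⊢*_BA`, formulated in countably many variables. -/
def logicBAStar : Logic.{u} :=
  inducedLogic boolLang.{u} (fun _ => inferInstanceAs (IsEmpty Empty)) ⟨fun f => nomatch f⟩
    (ULift.{u} ℕ) inferInstance boolMatrices

end LeibnizHierarchy

/-!
# Protoalgebraic logics are a meet of two larger Leibniz classes

**Leibniz conditions.** A translation that reaches every basic operation of the target language and
sends models to models is an interpretation (`Logic.le_of_covers`), since it leaves the congruences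
of the algebras unchanged. So it suffices to express a class of logics by rules over languages with
arbitrarily many further symbols. For protoalgebraic logics the rules say that a set of binary
implications is reflexive and satisfies modus ponens (`protoLogic`, `isProtoalgebraic_iff`); for
assertional logics they say that the filter is nonempty and lies in one block of the Leibniz
congruence (`asrtLogic`, `isAssertional_iff`).

**Suprema.** The meet of two logics with theorems in the interpretability order is their non-indexed
product (`prodLogic_le`, `le_prodLogic`). The reason is that every Suszko reduced model of the
product is the product of Suszko reduced models of the factors (`exists_decomposition`): the
decomposition operations given by the pairs of projections satisfy the identities of products, and
identities transfer to Suszko reduced models (`Logic.InducedBy.realize_eq`). Hence the supremum of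
two Leibniz classes is given by the products of the logics in their Leibniz conditions
(`exists_isLUB`).

**Intersection.** Suppose `l` interprets a product of a protoalgebraic and an assertional logic, and
also a product of a protoalgebraic logic and `⊢*_BA`. Then each Suszko reduced model `M` of `l`
decomposes both as `A × B` and as `A' × B'`, with `A` and `A'` models of protoalgebraic logics, the
filter of `B` a singleton, and `B'` Boolean. Let `a` and `b` be related by all the implications,
under all unary polynomials. Then `p(a)` and `p(b)` have the same components in `A` and in `A'`, for
each unary polynomial `p`. Take `p(x)` with a theorem as its component in `A'` and with `a ↔ x` as
its component in `B'`. Both `p(a)` and `p(b)` lie in the filter, so their components in `B` agree as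
well. Thus `p(a) = p(b)`, which means `a ↔ b = a ↔ a` in `B'`, and so `a = b`. This makes `l`
protoalgebraic (`isProtoalgebraic_of_separating`, `isProtoalgebraic_of_prodLogic_le`).

**Strictness.** Basic assertional logics and `⊢*_BA` are not protoalgebraic, by a two element and a
four element matrix (`not_isProtoalgebraic_asrtLogic`, `not_isProtoalgebraic_logicBAStar`).
-/

namespace LeibnizHierarchy

open FirstOrder FirstOrder.Language

/-! ### Unary polynomial functions and the Leibniz congruence -/

section

variable {L L' : FirstOrder.Language.{u, 0}}

/-- Unary polynomial functions of the algebra reduct of a matrix: the closure of the identity and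
the constants under the basic operations. -/
inductive LMatrix.IsPoly (M : LMatrix.{u} L) : (M.carrier → M.carrier) → Prop
  | id : IsPoly M fun x => x
  | const (c : M.carrier) : IsPoly M fun _ => c
  | func {n : ℕ} (f : L.Functions n) (g : Fin n → M.carrier → M.carrier)
      (h : ∀ i, IsPoly M (g i)) : IsPoly M fun x => Structure.funMap f fun i => g i x

lemma LMatrix.IsPoly.comp {M : LMatrix.{u} L} {p q : M.carrier → M.carrier}
    (hp : M.IsPoly p) (hq : M.IsPoly q) : M.IsPoly fun x => p (q x) := by
  induction hp with
  | id => exact hq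
  | const c => exact .const c
  | func f g _ ih => exact .func f _ ih

lemma LMatrix.IsPoly.term {M : LMatrix.{u} L} {X : Type*} (t : L.Term X)
    (g : X → M.carrier → M.carrier) (h : ∀ i, M.IsPoly (g i)) :
    M.IsPoly fun x => t.realize fun i => g i x := by
  induction t with
  | var i => exact h i
  | func f ts ih => exact .func f _ ih

/-- Every unary polynomial function is given by a term over the elements of the algebra and one
further variable `none`. -/
lemma LMatrix.IsPoly.exists_term {M : LMatrix.{u} L} {p : M.carrier → M.carrier}
    (hp : M.IsPoly p) :
    ∃ t : L.Term (Option M.carrier), ∀ x, p x = t.realize fun o => o.elim x fun c => c := by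
  induction hp with
  | id => exact ⟨.var none, fun _ => rfl⟩
  | const c => exact ⟨.var (some c), fun _ => rfl⟩
  | func f g _ ih =>
    choose t ht using ih
    exact ⟨.func f t, fun x => by simp [ht]⟩

lemma LMatrix.IsCongruence.realize {M : LMatrix.{u} L} {θ : Setoid M.carrier}
    (h : M.IsCongruence θ) {X : Type*} (t : L.Term X) {v w : X → M.carrier}
    (hvw : ∀ i, θ (v i) (w i)) : θ (t.realize v) (t.realize w) := by
  induction t with
  | var i => exact hvw i
  | func f ts ih => exact h _ f _ _ ih

lemma LMatrix.IsCongruence.poly {M : LMatrix.{u} L} {θ : Setoid M.carrier}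
    (h : M.IsCongruence θ) {p : M.carrier → M.carrier} (hp : M.IsPoly p) {a b : M.carrier}
    (hab : θ a b) : θ (p a) (p b) := by
  induction hp with
  | id => exact hab
  | const c => exact θ.refl' c
  | func f g _ ih => exact h _ f _ _ ih

/-- The equivalence relation of being indistinguishable by unary polynomial functions with respect
to a family of subsets `S` of the universe. -/
def LMatrix.polySetoid (M : LMatrix.{u} L) (S : Set (Set M.carrier)) : Setoid M.carrier where
  r a b := ∀ G ∈ S, ∀ p, M.IsPoly p → (p a ∈ G ↔ p b ∈ G)
  iseqv := ⟨fun _ _ _ _ _ => Iff.rfl, fun h G hG p hp => (h G hG p hp).symm,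
    fun h₁ h₂ G hG p hp => (h₁ G hG p hp).trans (h₂ G hG p hp)⟩

lemma LMatrix.isCongruence_polySetoid (M : LMatrix.{u} L) (S : Set (Set M.carrier)) :
    M.IsCongruence (M.polySetoid S) := by
  intro n f a b hab
  -- replace the arguments `a i` by `b i` one at a time
  have key : ∀ k ≤ n, M.polySetoid S (Structure.funMap f a)
      (Structure.funMap f fun i => if i.1 < k then b i else a i) := by
    intro k
    induction k with
    | zero => intro _; simp
    | succ k ih =>
      intro hk
      refine (M.polySetoid S).trans' (ih (by omega)) ?_
      intro G hG p hp
      have hq : M.IsPoly fun x => Structure.funMap f fun i : Fin n =>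
          if i.1 = k then x else if i.1 < k then b i else a i := by
        refine .func f (fun (i : Fin n) x =>
          if i.1 = k then x else if i.1 < k then b i else a i) fun i => ?_
        by_cases h : i.1 = k
        · simpa [h] using .id
        · simpa [h] using .const _
      have h := hab ⟨k, hk⟩ G hG _ (hp.comp hq)
      convert h using 4 <;> (funext i; rcases lt_trichotomy i.1 k with h | h | h)
      · simp [h, h.ne]
      · simp [show i = ⟨k, hk⟩ from Fin.ext h]
      · simp [h.not_gt, h.ne']
      · simp [h, h.ne, h.le]
      · simp [show i = ⟨k, hk⟩ from Fin.ext h]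
      · simp [h.not_gt, h.ne', show ¬ i.1 < k + 1 by omega]
  simpa using key n le_rfl

/-- Maltsev's description of the Leibniz congruence. -/
lemma LMatrix.leibniz_iff {M : LMatrix.{u} L} {a b : M.carrier} :
    M.Leibniz a b ↔ ∀ p, M.IsPoly p → (p a ∈ M.filter ↔ p b ∈ M.filter) := by
  constructor
  · rintro ⟨θ, hθ, hc, hab⟩ p hp
    exact ⟨hc _ _ (hθ.poly hp hab), hc _ _ (θ.symm' (hθ.poly hp hab))⟩
  · intro h
    refine ⟨M.polySetoid {M.filter}, M.isCongruence_polySetoid _, ?_, ?_⟩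
    · exact fun a b hab => (hab M.filter rfl _ .id).1
    · rintro _ rfl
      exact h

lemma LMatrix.Leibniz.mem {M : LMatrix.{u} L} {a b : M.carrier} (h : M.Leibniz a b)
    (ha : a ∈ M.filter) : b ∈ M.filter :=
  (LMatrix.leibniz_iff.1 h _ .id).1 ha

lemma LMatrix.Leibniz.rfl {M : LMatrix.{u} L} {a : M.carrier} : M.Leibniz a a :=
  LMatrix.leibniz_iff.2 fun _ _ => Iff.rfl

lemma LMatrix.isPoly_withFilter {M : LMatrix.{u} L} {G : Set M.carrier}
    {p : M.carrier → M.carrier} : (M.withFilter G).IsPoly p ↔ M.IsPoly p := by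
  constructor
  · exact @LMatrix.IsPoly.rec L (M.withFilter G) (fun p _ => M.IsPoly p)
      (LMatrix.IsPoly.id (M := M)) (fun c => LMatrix.IsPoly.const (M := M) c)
      (fun f g _ ih => LMatrix.IsPoly.func (M := M) f g ih) p
  · intro h
    induction h with
    | id => exact LMatrix.IsPoly.id (M := M.withFilter G)
    | const c => exact LMatrix.IsPoly.const (M := M.withFilter G) c
    | func f g _ ih => exact LMatrix.IsPoly.func (M := M.withFilter G) f g ih

lemma LMatrix.leibniz_withFilter_iff {M : LMatrix.{u} L} {G : Set M.carrier} {a b : M.carrier} :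
    (M.withFilter G).Leibniz a b ↔ ∀ p, M.IsPoly p → (p a ∈ G ↔ p b ∈ G) := by
  refine LMatrix.leibniz_iff.trans (forall_congr' fun p => ?_)
  exact imp_congr LMatrix.isPoly_withFilter Iff.rfl

/-! ### Homomorphisms of matrices -/

/-- Homomorphisms between the algebra reducts of matrices. -/
def LMatrix.IsHom (M N : LMatrix.{u} L) (h : M.carrier → N.carrier) : Prop :=
  ∀ (n : ℕ) (f : L.Functions n) (a : Fin n → M.carrier),
    h (Structure.funMap f a) = Structure.funMap f fun i => h (a i)

lemma LMatrix.IsHom.realize {M N : LMatrix.{u} L} {h : M.carrier → N.carrier} (hh : M.IsHom N h)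
    {X : Type*} (t : L.Term X) (v : X → M.carrier) :
    h (t.realize v) = t.realize fun i => h (v i) := by
  induction t with
  | var i => rfl
  | func f ts ih => simp [hh _ f, ih]

/-- Models are preserved under strict homomorphic preimages. -/
lemma LMatrix.IsHom.validates {M N : LMatrix.{u} L} {h : M.carrier → N.carrier}
    (hh : M.IsHom N h) (hF : ∀ x, x ∈ M.filter ↔ h x ∈ N.filter) {V : Type u}
    {Γ : Set (L.Term V)} {φ : L.Term V} (hN : N.Validates Γ φ) : M.Validates Γ φ := by
  intro v hv
  rw [hF, hh.realize]
  exact hN _ fun γ hγ => by rw [← hh.realize, ← hF]; exact hv γ hγ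

lemma LMatrix.IsHom.mem_mod {l : Logic.{u}} {M N : LMatrix.{u} l.lang}
    {h : M.carrier → N.carrier} (hh : M.IsHom N h)
    (hF : ∀ x, x ∈ M.filter ↔ h x ∈ N.filter) (hN : N ∈ Mod l) : M ∈ Mod l :=
  fun Γ φ hφ => hh.validates hF (hN Γ φ hφ)

/-- Models are preserved under strict surjective homomorphic images. -/
lemma LMatrix.IsHom.mem_mod_of_surjective {l : Logic.{u}} {M N : LMatrix.{u} l.lang}
    {h : M.carrier → N.carrier} (hh : M.IsHom N h) (hs : Function.Surjective h)
    (hF : ∀ x, x ∈ M.filter ↔ h x ∈ N.filter) (hM : M ∈ Mod l) : N ∈ Mod l := by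
  intro Γ φ hφ v hv
  obtain ⟨w, rfl⟩ : ∃ w : l.Var → M.carrier, v = fun i => h (w i) :=
    ⟨fun i => (hs (v i)).choose, funext fun i => (hs (v i)).choose_spec.symm⟩
  rw [← hh.realize, ← hF]
  refine hM Γ φ hφ w fun γ hγ => ?_
  rw [hF, hh.realize]
  exact hv γ hγ

lemma LMatrix.IsHom.exists_poly_lift {M N : LMatrix.{u} L}
    {h : M.carrier → N.carrier} (hh : M.IsHom N h) (hs : Function.Surjective h)
    {p : N.carrier → N.carrier} (hp : N.IsPoly p) :
    ∃ q, M.IsPoly q ∧ ∀ x, h (q x) = p (h x) := by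
  induction hp with
  | id => exact ⟨_, .id, fun _ => rfl⟩
  | const c => exact ⟨_, .const (hs c).choose, fun _ => (hs c).choose_spec⟩
  | func f g _ ih =>
    choose q hq hpq using ih
    exact ⟨_, .func f q hq, fun x => by simp [hh _ f, hpq]⟩

/-- Leibniz congruences commute with strict surjective homomorphisms. -/
lemma LMatrix.IsHom.leibniz_iff {M N : LMatrix.{u} L} {h : M.carrier → N.carrier}
    (hh : M.IsHom N h) (hs : Function.Surjective h)
    (hF : ∀ x, x ∈ M.filter ↔ h x ∈ N.filter) {a b : M.carrier} :
    M.Leibniz a b ↔ N.Leibniz (h a) (h b) := by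
  constructor
  · intro hab
    rw [LMatrix.leibniz_iff] at hab ⊢
    intro p hp
    obtain ⟨q, hq, hpq⟩ := hh.exists_poly_lift hs hp
    rw [← hpq, ← hpq, ← hF, ← hF]
    exact hab q hq
  · rintro ⟨θ, hθ, hc, hab⟩
    refine ⟨θ.comap h, fun n f a b h' => ?_, fun a b h' => ?_, hab⟩
    · change θ (h _) (h _)
      rw [hh, hh]
      exact hθ n f _ _ h'
    · rw [hF, hF]
      exact hc _ _ h'

lemma LMatrix.IsHom.withFilter {M N : LMatrix.{u} L} {h : M.carrier → N.carrier}
    (hh : M.IsHom N h) (G : Set M.carrier) (G' : Set N.carrier) :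
    (M.withFilter G).IsHom (N.withFilter G') h := hh

/-! ### Suszko congruences and reductions -/

lemma suszko_iff {l : Logic.{u}} {M : LMatrix.{u} l.lang} {a b : M.carrier} :
    SuszkoCongruence l M a b ↔
      M.polySetoid {G | M.filter ⊆ G ∧ M.withFilter G ∈ Mod l} a b :=
  ⟨fun h G hG => LMatrix.leibniz_withFilter_iff.1 (h G hG.1 hG.2),
    fun h G hG hG' => LMatrix.leibniz_withFilter_iff.2 (h G ⟨hG, hG'⟩)⟩

/-- The quotient of a matrix by an equivalence relation. Operations are computed on arbitrary
representatives, which is meaningful when the relation is a congruence. -/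
noncomputable def LMatrix.quotient (M : LMatrix.{u} L) (hL : L.IsAlgebraic)
    (θ : Setoid M.carrier) : LMatrix.{u} L where
  carrier := Quotient θ
  nonempty := M.nonempty.map (Quotient.mk θ)
  str :=
    { funMap := fun f a => Quotient.mk θ (Structure.funMap f fun i => (a i).out)
      RelMap := fun {n} R _ => (hL n).elim R }
  filter := Quotient.mk θ '' M.filter

lemma LMatrix.isHom_quotient {M : LMatrix.{u} L} (hL : L.IsAlgebraic) {θ : Setoid M.carrier}
    (hθ : M.IsCongruence θ) : M.IsHom (M.quotient hL θ) (Quotient.mk θ) :=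
  fun n f _ => Quotient.sound (hθ n f _ _ fun _ => θ.symm' (Quotient.mk_out _))

lemma LMatrix.mem_quotient_iff {M : LMatrix.{u} L} (hL : L.IsAlgebraic) {θ : Setoid M.carrier}
    (hθ : M.IsCompatible θ) (x : M.carrier) :
    x ∈ M.filter ↔ Quotient.mk θ x ∈ (M.quotient hL θ).filter :=
  ⟨fun h => ⟨x, h, rfl⟩, fun ⟨_, hy, hxy⟩ => hθ _ _ (Quotient.exact hxy) hy⟩

/-- Every model of a logic has a strict homomorphism onto a Suszko reduced model, whose kernel is
the Suszko congruence. -/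
lemma exists_reduction {l : Logic.{u}} {M : LMatrix.{u} l.lang} (hM : M ∈ Mod l) :
    ∃ (N : LMatrix.{u} l.lang) (h : M.carrier → N.carrier), N ∈ ModSuszko l ∧ M.IsHom N h ∧
      Function.Surjective h ∧ (∀ x, x ∈ M.filter ↔ h x ∈ N.filter) ∧
      ∀ a b, h a = h b → SuszkoCongruence l M a b := by
  set θ := M.polySetoid {G | M.filter ⊆ G ∧ M.withFilter G ∈ Mod l} with hθdef
  have hθ : M.IsCongruence θ := M.isCongruence_polySetoid _
  have hc : M.IsCompatible θ := fun a b hab => (hab M.filter ⟨subset_rfl, hM⟩ _ .id).1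
  have hh := LMatrix.isHom_quotient l.algebraic hθ
  have hs : Function.Surjective (Quotient.mk θ) := Quotient.mk_surjective
  have hF := LMatrix.mem_quotient_iff l.algebraic hc
  refine ⟨M.quotient l.algebraic θ, Quotient.mk θ, ⟨?_, ?_⟩, hh, hs, hF, ?_⟩
  · exact hh.mem_mod_of_surjective hs hF hM
  · intro a b hab
    obtain ⟨a, rfl⟩ := hs a
    obtain ⟨b, rfl⟩ := hs b
    refine Quotient.sound (suszko_iff.1 fun G hG hG' => ?_)
    have hcG : ∀ x, x ∈ G ↔ Quotient.mk θ x ∈ Quotient.mk θ '' G :=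
      fun x => ⟨fun h => ⟨x, h, rfl⟩, fun ⟨y, hy, hxy⟩ =>
        (Quotient.exact hxy G ⟨hG, hG'⟩ _ .id).1 hy⟩
    refine ((hh.withFilter G (Quotient.mk θ '' G)).leibniz_iff hs hcG).2 (hab _ ?_ ?_)
    · exact Set.image_mono hG
    · exact (hh.withFilter G (Quotient.mk θ '' G)).mem_mod_of_surjective hs hcG hG'
  · exact fun a b hab => suszko_iff.2 (Quotient.exact hab)

/-! ### Translations -/

lemma realize_translate (hL : L.IsAlgebraic) (τ : Translation L L') (M : LMatrix.{u} L')
    {X : Type*} (t : L.Term X) (v : X → M.carrier) :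
    Term.realize (M := (M.translate hL τ).carrier) v t =
      Term.realize (M := M.carrier) v (t.substFunc fun {n} f => τ n f) := by
  induction t with
  | var i => rfl
  | func f ts ih =>
    rw [Term.substFunc, Term.realize_subst]
    exact congrArg (fun w => Term.realize (M := M.carrier) w (τ _ f)) (funext ih)

lemma LMatrix.IsCongruence.translate {hL : L.IsAlgebraic} {τ : Translation L L'}
    {M : LMatrix.{u} L'} {θ : Setoid M.carrier} (h : M.IsCongruence θ) :
    (M.translate hL τ).IsCongruence θ :=
  fun n f _ _ hab => h.realize (τ n f) hab

lemma LMatrix.Leibniz.translate {hL : L.IsAlgebraic} {τ : Translation L L'}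
    {M : LMatrix.{u} L'} {a b : M.carrier} (h : M.Leibniz a b) :
    (M.translate hL τ).Leibniz a b :=
  let ⟨θ, hθ, hc, hab⟩ := h
  ⟨θ, hθ.translate, hc, hab⟩

lemma LMatrix.IsPoly.of_translate {hL : L.IsAlgebraic} {τ : Translation L L'}
    {M : LMatrix.{u} L'} {p : M.carrier → M.carrier} (hp : (M.translate hL τ).IsPoly p) :
    M.IsPoly p :=
  @LMatrix.IsPoly.rec L (M.translate hL τ) (fun p _ => M.IsPoly p)
    (LMatrix.IsPoly.id (M := M)) (fun c => LMatrix.IsPoly.const (M := M) c)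
    (fun f g _ ih => LMatrix.IsPoly.term (M := M) (τ _ f) g ih) p hp

lemma LMatrix.IsHom.translate {hL : L.IsAlgebraic} {τ : Translation L L'}
    {M N : LMatrix.{u} L'} {h : M.carrier → N.carrier} (hh : M.IsHom N h) :
    (M.translate hL τ).IsHom (N.translate hL τ) h :=
  fun n f a => hh.realize (τ n f) a

/-- An interpretation translates all models, not only the Suszko reduced ones. -/
lemma IsInterpretation.translate_mem_mod {l l' : Logic.{u}} {τ : Translation l.lang l'.lang}
    (hτ : IsInterpretation l l' τ) {M : LMatrix.{u} l'.lang} (hM : M ∈ Mod l') :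
    M.translate l.algebraic τ ∈ Mod l := by
  obtain ⟨N, h, hN, hh, _, hF, _⟩ := exists_reduction hM
  exact LMatrix.IsHom.mem_mod (hh.translate (hL := l.algebraic) (τ := τ)) hF (hτ N hN).1

lemma Logic.le_trans {l₁ l₂ l₃ : Logic.{u}} (h₁₂ : l₁ ≤ l₂) (h₂₃ : l₂ ≤ l₃) : l₁ ≤ l₃ := by
  obtain ⟨τ, hτ⟩ := h₁₂
  obtain ⟨σ, hσ⟩ := h₂₃
  refine ⟨fun n f => (τ n f).substFunc fun {n} f => σ n f, fun M hM => ?_⟩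
  have key : M.translate l₁.algebraic (fun n f => (τ n f).substFunc fun {n} f => σ n f) =
      (M.translate l₂.algebraic σ).translate l₁.algebraic τ := by
    unfold LMatrix.translate
    congr 2
    funext n f a
    exact (realize_translate l₂.algebraic σ M (τ n f) a).symm
  rw [key]
  exact hτ _ (hσ _ hM)

/-- A translation that reaches all basic operations and sends models to models is an
interpretation. -/
lemma Logic.le_of_covers {l l' : Logic.{u}} (τ : Translation l.lang l'.lang)
    (hcov : ∀ (n : ℕ) (f : l'.lang.Functions n), ∃ f', τ n f' = f.term)
    (hmod : ∀ M ∈ Mod l', M.translate l.algebraic τ ∈ Mod l) : l ≤ l' := by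
  refine ⟨τ, fun M hM => ⟨hmod M hM.1, fun a b hab => hM.2 a b fun G hG hG' => ?_⟩⟩
  obtain ⟨θ, hθ, hc, h⟩ := hab G hG (hmod _ hG')
  refine ⟨θ, fun n f a b hab => ?_, hc, h⟩
  obtain ⟨f', hf'⟩ := hcov n f
  have : θ (Term.realize (M := M.carrier) a (τ n f'))
    (Term.realize (M := M.carrier) b (τ n f')) := hθ n f' a b hab
  rwa [hf'] at this

lemma Logic.le_refl (l : Logic.{u}) : l ≤ l := by
  refine Logic.le_of_covers (fun _ f => f.term) (fun n f => ⟨f, rfl⟩) fun M hM => ?_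
  refine LMatrix.IsHom.mem_mod (N := M) (h := id) (fun n f a => rfl) (fun _ => Iff.rfl) hM

end

/-! ### Rules and equations in models of a logic -/

section
variable {L : FirstOrder.Language.{u, 0}}

/-- Terms depend on finitely many variables only. -/
lemma term_exists_support {Y Z : Type*} (t : L.Term Y) :
    ∃ S : Set Y, S.Finite ∧ ∀ f g : Y → Z, Set.EqOn f g S → t.relabel f = t.relabel g := by
  induction t with
  | var y => exact ⟨{y}, Set.finite_singleton y, fun f g h => congrArg Term.var (h rfl)⟩
  | func f ts ih =>
    choose S hS h using ih
    refine ⟨⋃ i, S i, Set.finite_iUnion hS, fun g g' hg => ?_⟩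
    simp only [Term.relabel]
    congr 1
    funext i
    exact h i g g' fun y hy => hg (Set.mem_iUnion.2 ⟨i, hy⟩)

/-- A finite set of terms over arbitrary variables can be renamed reversibly to an infinite set of
variables. -/
lemma exists_renaming {Y V : Type*} [Nonempty Y] [Infinite V] {T : Set (L.Term Y)}
    (hT : T.Finite) :
    ∃ (f : Y → V) (g : V → Y), ∀ t ∈ T, t.relabel (g ∘ f) = t := by
  choose S hS h using fun t : L.Term Y => term_exists_support (Z := Y) t
  have hfin : (⋃ t ∈ T, S t).Finite := hT.biUnion fun t _ => hS t
  obtain ⟨f, -, hf⟩ := hfin.exists_injOn_of_encard_le (t := (Set.univ : Set V)) (by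
    simp [Set.encard_univ])
  refine ⟨f, Function.invFunOn f (⋃ t ∈ T, S t), fun t ht => ?_⟩
  refine (h t _ id fun y hy => ?_).trans (Term.relabel_id t)
  exact hf.leftInvOn_invFunOn (Set.mem_biUnion ht hy)

end

/-- `l` is the consequence relation of the class `K` of matrices. -/
def Logic.InducedBy (l : Logic.{u}) (K : Set (LMatrix.{u} l.lang)) : Prop :=
  ∀ Γ φ, l.Entails Γ φ ↔ ∀ M ∈ K, M.Validates Γ φ

/-- Without variables there are no terms, as there are no constant symbols. -/
lemma isEmpty_term (l : Logic.{u}) (Y : Type*) [hY : IsEmpty Y] : IsEmpty (l.lang.Term Y) := by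
  refine ⟨fun t => ?_⟩
  induction t with
  | var y => exact hY.elim y
  | @func n f ts ih =>
    rcases n with _ | n
    · exact l.noConstants.elim f
    · exact ih 0

namespace Logic.InducedBy

variable {l : Logic.{u}} {K : Set (LMatrix.{u} l.lang)}

lemma subset_mod (hK : l.InducedBy K) : K ⊆ Mod l :=
  fun M hM Γ φ h => (hK Γ φ).1 h M hM

lemma rule_of_renaming (hK : l.InducedBy K) {N : LMatrix.{u} l.lang} (hN : N ∈ Mod l)
    {Y : Type*} {Γ : Set (l.lang.Term Y)} {φ : l.lang.Term Y} (f : Y → l.Var) (g : l.Var → Y)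
    (hΓ : ∀ γ ∈ Γ, γ.relabel (g ∘ f) = γ) (hφ : φ.relabel (g ∘ f) = φ)
    (h : ∀ M ∈ K, ∀ w : Y → M.carrier, (∀ γ ∈ Γ, γ.realize w ∈ M.filter) →
      φ.realize w ∈ M.filter)
    (w : Y → N.carrier) (hw : ∀ γ ∈ Γ, γ.realize w ∈ N.filter) : φ.realize w ∈ N.filter := by
  have := hN ((fun γ => γ.relabel f) '' Γ) (φ.relabel f) ((hK _ _).2 fun M hM v hv => by
    rw [Term.realize_relabel]
    refine h M hM _ fun γ hγ => ?_
    rw [← Term.realize_relabel]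
    exact hv _ ⟨γ, hγ, rfl⟩) (w ∘ g) (by
      rintro _ ⟨γ, hγ, rfl⟩
      rw [Term.realize_relabel, Function.comp_assoc, ← Term.realize_relabel, hΓ γ hγ]
      exact hw γ hγ)
  rwa [Term.realize_relabel, Function.comp_assoc, ← Term.realize_relabel, hφ] at this

/-- Rules with finitely many premises, over arbitrary variables, that hold in `K` hold in all
models. -/
lemma rule_of_finite (hK : l.InducedBy K) {N : LMatrix.{u} l.lang} (hN : N ∈ Mod l)
    {Y : Type*} {Γ : Set (l.lang.Term Y)} (hfin : Γ.Finite) {φ : l.lang.Term Y}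
    (h : ∀ M ∈ K, ∀ w : Y → M.carrier, (∀ γ ∈ Γ, γ.realize w ∈ M.filter) →
      φ.realize w ∈ M.filter)
    (w : Y → N.carrier) (hw : ∀ γ ∈ Γ, γ.realize w ∈ N.filter) : φ.realize w ∈ N.filter := by
  have := l.infinite
  rcases isEmpty_or_nonempty Y with hY | hY
  · exact (isEmpty_term l Y).elim φ
  obtain ⟨f, g, hfg⟩ := exists_renaming (V := l.Var) (hfin.insert φ)
  exact hK.rule_of_renaming hN f g (fun γ hγ => hfg γ (.inr hγ)) (hfg φ (.inl rfl)) h w hw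

/-- Rules over at most as many variables as the logic has that hold in `K` hold in all models. -/
lemma rule_of_injective (hK : l.InducedBy K) {N : LMatrix.{u} l.lang} (hN : N ∈ Mod l)
    {Y : Type*} [Nonempty Y] {f : Y → l.Var} (hf : f.Injective)
    {Γ : Set (l.lang.Term Y)} {φ : l.lang.Term Y}
    (h : ∀ M ∈ K, ∀ w : Y → M.carrier, (∀ γ ∈ Γ, γ.realize w ∈ M.filter) →
      φ.realize w ∈ M.filter)
    (w : Y → N.carrier) (hw : ∀ γ ∈ Γ, γ.realize w ∈ N.filter) : φ.realize w ∈ N.filter := by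
  have hfg : Function.invFun f ∘ f = id := Function.invFun_comp hf
  refine hK.rule_of_renaming hN f (Function.invFun f) (fun γ _ => ?_) ?_ h w hw <;>
    rw [hfg, Term.relabel_id]

/-- Equations that hold in `K` hold in all Suszko reduced models. -/
lemma realize_eq (hK : l.InducedBy K) {N : LMatrix.{u} l.lang} (hN : N ∈ ModSuszko l)
    {X : Type*} {s t : l.lang.Term X}
    (h : ∀ M ∈ K, ∀ w : X → M.carrier, s.realize w = t.realize w) (w : X → N.carrier) :
    s.realize w = t.realize w := by
  refine hN.2 _ _ fun G hG hGm => LMatrix.leibniz_withFilter_iff.2 fun p hp => ?_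
  obtain ⟨r, hr⟩ := hp.exists_term
  -- `r` with `t'` plugged in for the distinguished variable, as a term over the elements of `N`
  let plug : l.lang.Term X → l.lang.Term N.carrier := fun t' =>
    r.subst fun o => o.elim (t'.relabel w) Term.var
  have hplug : ∀ (M : LMatrix.{u} l.lang) (t' : l.lang.Term X) (v : N.carrier → M.carrier),
      (plug t').realize v = r.realize fun o => o.elim (t'.realize (v ∘ w)) v := by
    intro M t' v
    rw [Term.realize_subst]
    congr 1
    funext o
    cases o <;> simp
  have hN' : ∀ t', (plug t').realize (fun c : N.carrier => c) = p (t'.realize w) := fun t' => by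
    rw [hplug, hr]; rfl
  have main : ∀ s t : l.lang.Term X,
      (∀ M ∈ K, ∀ w : X → M.carrier, s.realize w = t.realize w) →
      p (s.realize w) ∈ G → p (t.realize w) ∈ G := by
    intro s t h hs
    rw [← hN'] at hs ⊢
    refine hK.rule_of_finite hGm (Γ := {plug s}) (Set.finite_singleton _) (φ := plug t) ?_
      (fun c : N.carrier => c) (by rintro _ rfl; exact hs)
    intro M hM v hv
    have := hv _ rfl
    rw [hplug] at this ⊢
    rwa [← h M hM]
  exact ⟨main s t h, main t s fun M hM w => (h M hM w).symm⟩

end Logic.InducedBy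

lemma inducedLogic_inducedBy (L : FirstOrder.Language.{u, 0}) (hL : L.IsAlgebraic)
    (hL₀ : IsEmpty L.Constants) (V : Type u) (hV : Infinite V) (K : Set (LMatrix.{u} L)) :
    (inducedLogic L hL hL₀ V hV K).InducedBy K := fun _ _ => Iff.rfl

/-! ### Models on the algebra of formulas -/

/-- The algebra of formulas with a set of formulas. -/
def Logic.fmMatrix (l : Logic.{u}) (T : Set l.Fm) : LMatrix.{u} l.lang where
  carrier := l.Fm
  nonempty := have := l.infinite; ⟨.var (Classical.arbitrary _)⟩
  str :=
    { funMap := fun f ts => .func f ts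
      RelMap := fun {n} R _ => (l.algebraic n).elim R }
  filter := T

lemma realize_fmMatrix {l : Logic.{u}} (T : Set l.Fm) {X : Type*} (t : l.lang.Term X)
    (v : X → l.Fm) : Term.realize (M := (l.fmMatrix T).carrier) v t = t.subst v := by
  induction t with
  | var x => rfl
  | func f ts ih => exact congrArg (Term.func f) (funext ih)

lemma realize_mem_fmMatrix_iff {l : Logic.{u}} {T : Set l.Fm} {X : Type*} (t : l.lang.Term X)
    (v : X → l.Fm) :
    Term.realize (M := (l.fmMatrix T).carrier) v t ∈ (l.fmMatrix T).filter ↔ t.subst v ∈ T :=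
  iff_of_eq (congrArg (· ∈ T) (realize_fmMatrix T t v))

lemma fmMatrix_mem_mod {l : Logic.{u}} {T : Set l.Fm}
    (hT : ∀ φ, l.Entails T φ → φ ∈ T) : l.fmMatrix T ∈ Mod l := by
  intro Γ φ h v hv
  refine (realize_mem_fmMatrix_iff φ v).2 (hT _ (l.cut _ _ _ ?_ (l.structural v Γ φ h)))
  rintro _ ⟨γ, hγ, rfl⟩
  exact l.refl _ _ ((realize_mem_fmMatrix_iff γ v).1 (hv γ hγ))

/-- The formulas that hold under a given class of assignments into models form a theory. -/
lemma fmMatrix_mem_mod_of_assignments (l : Logic.{u})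
    (C : ∀ M : LMatrix.{u} l.lang, (l.Var → M.carrier) → Prop) :
    l.fmMatrix {φ | ∀ M ∈ Mod l, ∀ v, C M v → φ.realize v ∈ M.filter} ∈ Mod l :=
  fmMatrix_mem_mod fun φ h M hM v hv => hM _ φ h v fun _ hγ => hγ M hM v hv

/-- Interpretations preserve the existence of theorems. -/
lemma Logic.HasTheorems.mono {l l' : Logic.{u}} (hl : l.HasTheorems) (h : l ≤ l') :
    l'.HasTheorems := by
  obtain ⟨φ, hφ⟩ := hl
  obtain ⟨τ, hτ⟩ := h
  have hM := hτ.translate_mem_mod (fmMatrix_mem_mod (l := l') (T := {φ | l'.Entails ∅ φ})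
    fun φ h => l'.cut _ _ _ (fun _ h => h) h)
  have := l'.infinite
  exact ⟨_, hM ∅ φ hφ (fun _ => (Term.var (Classical.arbitrary _) : l'.Fm)) (by simp)⟩

/-- A logic with theorems has one in a single variable. -/
lemma Logic.HasTheorems.exists_unary {l : Logic.{u}} (hl : l.HasTheorems) :
    ∃ t : l.lang.Term (Fin 1), ∀ M ∈ Mod l, ∀ v, t.realize v ∈ M.filter := by
  obtain ⟨φ, hφ⟩ := hl
  refine ⟨φ.relabel fun _ => 0, fun M hM v => ?_⟩
  rw [Term.realize_relabel]
  exact hM ∅ φ hφ _ (by simp)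

/-- A logic all of whose Suszko reduced models have nonempty filters has theorems. -/
lemma hasTheorems_of_filter_nonempty {l : Logic.{u}}
    (h : ∀ M ∈ ModSuszko l, M.filter.Nonempty) : l.HasTheorems := by
  obtain ⟨N, f, hN, -, hs, hF, -⟩ := exists_reduction
    (fmMatrix_mem_mod (l := l) (T := {φ | l.Entails ∅ φ}) fun φ h => l.cut _ _ _ (fun _ h => h) h)
  obtain ⟨x, hx⟩ := h N hN
  obtain ⟨φ, rfl⟩ := hs x
  exact ⟨φ, (hF φ).2 hx⟩

/-! ### Non-indexed products of two logics -/

section Product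

variable (l : Bool → Logic.{u})

lemma Logic.nonempty_fin (l : Logic.{u}) {n : ℕ} (t : l.lang.Term (Fin n)) : Nonempty (Fin n) := by
  by_contra h
  have := not_nonempty_iff.1 h
  exact (isEmpty_term l (Fin n)).elim t

/-- The language of the non-indexed product: an `n`-ary symbol is a pair of `n`-ary terms of the
two factors. -/
def prodLang : FirstOrder.Language.{u, 0} :=
  ⟨fun n => ∀ i, (l i).lang.Term (Fin n), fun _ => Empty⟩

variable {l} in
/-- The non-indexed product of two matrices. -/
def prodMatrix (P : ∀ i, LMatrix.{u} (l i).lang) : LMatrix.{u} (prodLang l) where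
  carrier := ∀ i, (P i).carrier
  nonempty := ⟨fun i => (P i).nonempty.some⟩
  str :=
    { funMap := fun {n} (s : ∀ i, (l i).lang.Term (Fin n)) a i => (s i).realize fun k => a k i
      RelMap := fun R _ => Empty.elim R }
  filter := {x | ∀ i, x i ∈ (P i).filter}

/-- The non-indexed product of two logics, induced by the products of their models. The set of
variables is large enough to rename the variables of either factor together with one more. -/
def prodLogic : Logic.{u} :=
  inducedLogic (prodLang l) (fun _ => inferInstanceAs (IsEmpty Empty))
    ⟨fun s : ∀ i, (l i).lang.Term (Fin 0) => (isEmpty_term (l true) (Fin 0)).elim (s true)⟩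
    (Σ i, Option (l i).Var)
    (have := (l true).infinite
     Infinite.of_injective (fun x : (l true).Var => (⟨true, some x⟩ : Σ i, Option (l i).Var))
      fun x y h => by simpa using h)
    {N | ∃ P : ∀ i, LMatrix.{u} (l i).lang, (∀ i, P i ∈ Mod (l i)) ∧ N = prodMatrix P}

variable {l}

/-- Evaluation of terms in a product of matrices, computed in each component. -/
def prodEval {Y : Type*} (P : ∀ i, LMatrix.{u} (l i).lang) (w : Y → ∀ i, (P i).carrier) :
    (prodLogic l).lang.Term Y → ∀ i, (P i).carrier
  | .var y => w y
  | .func (s : ∀ i, (l i).lang.Term (Fin _)) ts => fun i =>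
      (s i).realize fun k => prodEval P w (ts k) i

lemma realize_prodMatrix {Y : Type*} (P : ∀ i, LMatrix.{u} (l i).lang)
    (w : Y → ∀ i, (P i).carrier) (t : (prodLogic l).lang.Term Y) :
    Term.realize (L := prodLang l) (M := (prodMatrix P).carrier) w t = prodEval P w t := by
  induction t with
  | var y => rfl
  | func s ts ih =>
    funext i
    exact congrArg (Term.realize · (_ : (l i).lang.Term (Fin _)))
      (funext fun k => congrFun (ih k) i)

lemma realize_prodMatrix_mem_iff {Y : Type*} (P : ∀ i, LMatrix.{u} (l i).lang)
    (w : Y → ∀ i, (P i).carrier) (t : (prodLogic l).lang.Term Y) (i : Bool) :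
    Term.realize (L := prodLang l) (M := (prodMatrix P).carrier) w t i ∈ (P i).filter ↔
      prodEval P w t i ∈ (P i).filter :=
  iff_of_eq (congrArg (fun x : ∀ i, (P i).carrier => x i ∈ (P i).filter) (realize_prodMatrix P w t))

lemma prodLogic_rule_of_injective {N : LMatrix.{u} (prodLogic l).lang}
    (hN : N ∈ Mod (prodLogic l)) {Y : Type*} [Nonempty Y] {f : Y → Σ i, Option (l i).Var}
    (hf : f.Injective) {Γ : Set ((prodLogic l).lang.Term Y)} {φ : (prodLogic l).lang.Term Y}
    (h : ∀ P : ∀ i, LMatrix.{u} (l i).lang, (∀ i, P i ∈ Mod (l i)) →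
      ∀ w : Y → ∀ i, (P i).carrier, (∀ γ ∈ Γ, ∀ i, prodEval P w γ i ∈ (P i).filter) →
      ∀ i, prodEval P w φ i ∈ (P i).filter)
    (w : Y → N.carrier) (hw : ∀ γ ∈ Γ, γ.realize w ∈ N.filter) : φ.realize w ∈ N.filter := by
  refine (inducedLogic_inducedBy _ _ _ _ _ _).rule_of_injective hN hf ?_ w hw
  rintro _ ⟨P, hP, rfl⟩ w hw i
  exact (realize_prodMatrix_mem_iff P w φ i).2
    (h P hP w (fun γ hγ i => (realize_prodMatrix_mem_iff P w γ i).1 (hw γ hγ i)) i)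

lemma prodLogic_rule_of_finite {N : LMatrix.{u} (prodLogic l).lang}
    (hN : N ∈ Mod (prodLogic l)) {Y : Type*}
    {Γ : Set ((prodLogic l).lang.Term Y)} (hΓ : Γ.Finite) {φ : (prodLogic l).lang.Term Y}
    (h : ∀ P : ∀ i, LMatrix.{u} (l i).lang, (∀ i, P i ∈ Mod (l i)) →
      ∀ w : Y → ∀ i, (P i).carrier, (∀ γ ∈ Γ, ∀ i, prodEval P w γ i ∈ (P i).filter) →
      ∀ i, prodEval P w φ i ∈ (P i).filter)
    (w : Y → N.carrier) (hw : ∀ γ ∈ Γ, γ.realize w ∈ N.filter) : φ.realize w ∈ N.filter := by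
  refine (inducedLogic_inducedBy _ _ _ _ _ _).rule_of_finite hN hΓ ?_ w hw
  rintro _ ⟨P, hP, rfl⟩ w hw i
  exact (realize_prodMatrix_mem_iff P w φ i).2
    (h P hP w (fun γ hγ i => (realize_prodMatrix_mem_iff P w γ i).1 (hw γ hγ i)) i)

lemma prodLogic_realize_eq {N : LMatrix.{u} (prodLogic l).lang}
    (hN : N ∈ ModSuszko (prodLogic l)) {X : Type*} {s t : (prodLogic l).lang.Term X}
    (h : ∀ (P : ∀ i, LMatrix.{u} (l i).lang) (w : X → ∀ i, (P i).carrier) (i : Bool),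
      prodEval P w s i = prodEval P w t i) (w : X → N.carrier) :
    s.realize w = t.realize w := by
  refine (inducedLogic_inducedBy _ _ _ _ _ _).realize_eq hN ?_ w
  rintro _ ⟨P, -, rfl⟩ w
  exact (realize_prodMatrix P w s).trans ((funext (h P w)).trans (realize_prodMatrix P w t).symm)

/-- The binary decomposition symbol taking the `i`-th component of its first argument and the
other component of its second argument. -/
def decompSymbol (l : Bool → Logic.{u}) (i : Bool) : (prodLogic l).lang.Functions 2 :=
  fun j : Bool => if j = i then (.var 0 : (l j).lang.Term (Fin 2)) else .var 1

/-- A symbol of the product acting as the term `t` in the `i`-th component. -/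
noncomputable def liftSymbol (i : Bool) {n : ℕ} (t : (l i).lang.Term (Fin n)) :
    (prodLogic l).lang.Functions n :=
  fun j : Bool => if h : j = i then (h ▸ t : (l j).lang.Term (Fin n))
    else .var ((l i).nonempty_fin t).some

lemma liftSymbol_self (i : Bool) {n : ℕ} (t : (l i).lang.Term (Fin n)) :
    (liftSymbol i t : ∀ j, (l j).lang.Term (Fin n)) i = t := by
  simp [liftSymbol]

/-- The term `decompSymbol l i (s, t)`. -/
def decomp (i : Bool) {Y : Type*} (s t : (prodLogic l).lang.Term Y) :
    (prodLogic l).lang.Term Y :=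
  (decompSymbol l i).apply₂ s t

lemma prodEval_decomp {P : ∀ i, LMatrix.{u} (l i).lang} {Y : Type*} (w : Y → ∀ i, (P i).carrier)
    (i j : Bool) (s t : (prodLogic l).lang.Term Y) :
    prodEval P w (decomp i s t) j = if j = i then prodEval P w s j else prodEval P w t j := by
  change Term.realize _ (ite _ _ _ : (l j).lang.Term (Fin 2)) = _
  split_ifs <;> rfl

/-- Terms of the `i`-th factor as terms of the product, where the other component is that of the
additional variable `none`. -/
noncomputable def liftTerm (i : Bool) {X : Type*} :
    (l i).lang.Term X → (prodLogic l).lang.Term (Option X)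
  | .var x => decomp i (.var (some x)) (.var none)
  | .func f ts =>
    decomp i (.func (liftSymbol i f.term) fun k => liftTerm i (ts k)) (.var none)

lemma prodEval_liftTerm {P : ∀ i, LMatrix.{u} (l i).lang} {X : Type*} (i : Bool)
    (w : Option X → ∀ i, (P i).carrier) (t : (l i).lang.Term X) (j : Bool) :
    prodEval P w (liftTerm i t) j =
      if h : j = i then h ▸ t.realize fun x => w (some x) i else w none j := by
  split_ifs with h
  · subst h
    induction t with
    | var x => simp [liftTerm, prodEval_decomp, prodEval]
    | func f ts ih =>
      rw [liftTerm, prodEval_decomp, if_pos rfl]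
      change Term.realize _ ((liftSymbol j f.term : ∀ i, (l i).lang.Term (Fin _)) j) = _
      rw [liftSymbol_self]
      simp [ih]
  · cases t <;> rw [liftTerm, prodEval_decomp, if_neg h] <;> rfl

/-- The decomposition operations of an algebra in the language of a product. -/
def LMatrix.opD (N : LMatrix.{u} (prodLogic l).lang) (i : Bool) (x y : N.carrier) : N.carrier :=
  Structure.funMap (decompSymbol l i) ![x, y]

lemma realize_decomp {N : LMatrix.{u} (prodLogic l).lang} {Y : Type*} (w : Y → N.carrier)
    (i : Bool) (s t : (prodLogic l).lang.Term Y) :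
    (decomp i s t).realize w = N.opD i (s.realize w) (t.realize w) :=
  Term.realize_functions_apply₂

section Identities

variable {N : LMatrix.{u} (prodLogic l).lang} (hN : N ∈ ModSuszko (prodLogic l))
include hN

lemma opD_self (i : Bool) (x : N.carrier) : N.opD i x x = x := by
  have := prodLogic_realize_eq hN (s := decomp i (.var x) (.var x)) (t := .var x)
    (fun P w j => by simp [prodEval_decomp]) id
  simpa [realize_decomp] using this

lemma opD_left (i : Bool) (x y z : N.carrier) : N.opD i (N.opD i x y) z = N.opD i x z := by
  have := prodLogic_realize_eq hN (s := decomp i (decomp i (.var x) (.var y)) (.var z))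
    (t := decomp i (.var x) (.var z))
    (fun P w j => by simp only [prodEval_decomp]; split_ifs <;> rfl) id
  simpa [realize_decomp] using this

lemma opD_right (i : Bool) (x y z : N.carrier) : N.opD i x (N.opD i y z) = N.opD i x z := by
  have := prodLogic_realize_eq hN (s := decomp i (.var x) (decomp i (.var y) (.var z)))
    (t := decomp i (.var x) (.var z))
    (fun P w j => by simp only [prodEval_decomp]; split_ifs <;> rfl) id
  simpa [realize_decomp] using this

lemma opD_not (i : Bool) (x y : N.carrier) : N.opD (!i) x y = N.opD i y x := by
  have := prodLogic_realize_eq hN (s := decomp (!i) (.var x) (.var y))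
    (t := decomp i (.var y) (.var x))
    (fun P w j => by simp only [prodEval_decomp]; cases i <;> cases j <;> rfl) id
  simpa [realize_decomp] using this

/-- An element is determined by its two components. -/
lemma opD_ext {o x y : N.carrier} (h : ∀ i, N.opD i x o = N.opD i y o) : x = y := by
  have key : ∀ z, z = N.opD true (N.opD true z o) (N.opD false z o) := fun z => by
    rw [opD_left hN, show N.opD false z o = N.opD true o z from opD_not hN true z o,
      opD_right hN, opD_self hN]
  rw [key x, key y, h, h]

end Identities

/-- The filters of models of the product are determined by the components. -/
lemma mem_filter_iff_opD {N : LMatrix.{u} (prodLogic l).lang} (hN : N ∈ Mod (prodLogic l))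
    {o : N.carrier} (ho : o ∈ N.filter) (x : N.carrier) :
    x ∈ N.filter ↔ ∀ i, N.opD i x o ∈ N.filter := by
  constructor
  · intro hx i
    have := prodLogic_rule_of_finite hN (Γ := {.var x, .var o}) (Set.toFinite _)
      (φ := decomp i (.var x) (.var o)) (fun P _ w hw j => by
        have hx := hw _ (.inl rfl) j
        have ho := hw _ (.inr rfl) j
        rw [prodEval_decomp]
        split_ifs <;> assumption) id (by rintro _ (rfl | rfl) <;> assumption)
    rwa [realize_decomp] at this
  · intro hx
    exact prodLogic_rule_of_finite hN
      (Γ := {decomp true (.var x) (.var o), decomp false (.var x) (.var o)}) (Set.toFinite _)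
      (φ := .var x) (fun P _ w hw j => by
        have h₁ := hw _ (.inl rfl) j
        have h₂ := hw _ (.inr rfl) j
        rw [prodEval_decomp] at h₁ h₂
        cases j
        · simpa using h₂
        · simpa using h₁) id (by
          rintro _ (rfl | rfl) <;> rw [realize_decomp]
          · exact hx true
          · exact hx false)

/-- The `i`-th factor of a Suszko reduced model of a product, with respect to a base point `o` and
a subset `G`: it is realized on the elements that agree with `o` in the other component. -/
noncomputable def factor {N : LMatrix.{u} (prodLogic l).lang} (hN : N ∈ ModSuszko (prodLogic l))
    (o : N.carrier) (i : Bool) (G : Set N.carrier) : LMatrix.{u} (l i).lang where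
  carrier := {x : N.carrier // N.opD i x o = x}
  nonempty := ⟨⟨o, opD_self hN i o⟩⟩
  str :=
    { funMap := fun f a =>
        ⟨N.opD i (Structure.funMap (liftSymbol i f.term) fun k => (a k).1) o, opD_left hN _ _ _ _⟩
      RelMap := fun {n} R _ => ((l i).algebraic n).elim R }
  filter := {x | x.1 ∈ G}

section Factor

variable {N : LMatrix.{u} (prodLogic l).lang} (hN : N ∈ ModSuszko (prodLogic l)) (o : N.carrier)

/-- The projection onto a factor. -/
noncomputable def factorProj (i : Bool) (G : Set N.carrier) (x : N.carrier) :
    (factor hN o i G).carrier :=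
  ⟨N.opD i x o, opD_left hN _ _ _ _⟩

lemma realize_factorProj (i : Bool) (G : Set N.carrier) {X : Type*} (t : (l i).lang.Term X)
    (v : X → N.carrier) :
    (t.realize fun x => factorProj hN o i G (v x)).1 =
      (liftTerm i t).realize fun x => x.elim o v := by
  induction t with
  | var x =>
    rw [liftTerm, realize_decomp]
    rfl
  | func f ts ih =>
    rw [liftTerm, realize_decomp]
    change N.opD i (Structure.funMap _ fun k => _) o = _
    simp only [ih]
    rfl

lemma factorProj_coe (i : Bool) (G : Set N.carrier) (x : (factor hN o i G).carrier) :
    factorProj hN o i G x.1 = x := Subtype.ext x.2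

lemma realize_factor (i : Bool) (G : Set N.carrier) {X : Type*} (t : (l i).lang.Term X)
    (v : X → (factor hN o i G).carrier) :
    (t.realize v).1 = (liftTerm i t).realize fun x => x.elim o fun x => (v x).1 := by
  rw [← realize_factorProj hN o i G]
  simp only [factorProj_coe]

lemma factorProj_funMap (i : Bool) (G : Set N.carrier) {n : ℕ}
    (s : ∀ i, (l i).lang.Term (Fin n)) (a : Fin n → N.carrier) :
    factorProj hN o i G (Structure.funMap (L := (prodLogic l).lang) s a) =
      (s i).realize fun k => factorProj hN o i G (a k) := by
  apply Subtype.ext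
  rw [realize_factorProj]
  refine Eq.trans ?_ (prodLogic_realize_eq hN
    (s := decomp i (.func (L := (prodLogic l).lang) s fun k => .var (some k)) (.var none))
    (t := liftTerm i (s i)) (fun P w j => ?_) fun x => x.elim o a)
  · rw [realize_decomp]
    rfl
  · rw [prodEval_decomp, prodEval_liftTerm]
    split_ifs with h
    · subst h; rfl
    · rfl

lemma factor_mem_mod (i : Bool) {G : Set N.carrier} (hG : N.withFilter G ∈ Mod (prodLogic l))
    (ho : o ∈ G) : factor hN o i G ∈ Mod (l i) := by
  intro Γ φ h v hv
  have hf : Function.Injective fun x : Option (l i).Var => (⟨i, x⟩ : Σ i, Option (l i).Var) :=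
    fun x y h => by simpa using h
  change (φ.realize v).1 ∈ G
  rw [realize_factor]
  refine prodLogic_rule_of_injective hG hf (Γ := insert (.var none) (liftTerm i '' Γ))
    (φ := liftTerm i φ) (fun P hP w hw j => ?_) (fun x => x.elim o fun x => (v x).1) ?_
  · rw [prodEval_liftTerm]
    split_ifs with hj
    · subst hj
      refine hP j Γ φ h _ fun γ hγ => ?_
      have := hw _ (.inr ⟨γ, hγ, rfl⟩) j
      rwa [prodEval_liftTerm, dif_pos rfl] at this
    · exact hw _ (.inl rfl) j
  · rintro _ (rfl | ⟨γ, hγ, rfl⟩)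
    · exact ho
    · have : (γ.realize v).1 ∈ G := hv γ hγ
      rwa [realize_factor] at this

lemma factor_mem_modSuszko (i : Bool) (ho : o ∈ N.filter) :
    factor hN o i N.filter ∈ ModSuszko (l i) := by
  refine ⟨factor_mem_mod hN o i hN.1 ho, fun a b hab => Subtype.ext (hN.2 _ _ fun G hG hGm => ?_)⟩
  obtain ⟨θ, hθ, hc, h⟩ := hab {x | x.1 ∈ G} (fun x hx => hG hx) (factor_mem_mod hN o i hGm (hG ho))
  -- pull back `θ` along the `i`-th projection and equality along the other one
  let θ' : Setoid N.carrier := θ.comap (factorProj hN o i N.filter) ⊓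
    Setoid.ker (factorProj hN o (!i) N.filter)
  have hnot : ∀ x : (factor hN o i N.filter).carrier, N.opD (!i) x.1 o = o := fun x => by
    rw [← x.2, opD_not hN, opD_right hN, opD_self hN]
  refine ⟨θ', fun n s a b hab => ⟨?_, ?_⟩, ?_, ⟨?_, ?_⟩⟩
  · change θ (factorProj hN o i N.filter _) (factorProj hN o i N.filter _)
    have := (show (factor hN o i N.filter).IsCongruence θ from hθ).realize
      ((s : ∀ i, (l i).lang.Term (Fin n)) i) fun k => (hab k).1
    exact (iff_of_eq (congrArg₂ (fun x y => θ x y) (factorProj_funMap hN o i N.filter s a)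
      (factorProj_funMap hN o i N.filter s b))).2 this
  · change factorProj hN o (!i) N.filter _ = factorProj hN o (!i) N.filter _
    refine (factorProj_funMap hN o (!i) N.filter s a).trans (Eq.trans ?_
      (factorProj_funMap hN o (!i) N.filter s b).symm)
    congr 1
    funext k
    exact (hab k).2
  · intro x y hxy hx
    have hx' := (mem_filter_iff_opD hGm (o := o) (hG ho) x).1 hx
    refine (mem_filter_iff_opD hGm (o := o) (hG ho) y).2 fun j => ?_
    by_cases hj : j = i
    · subst hj
      exact hc _ _ hxy.1 (hx' j)
    · obtain rfl : j = !i := by cases i <;> cases j <;> simp_all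
      have : N.opD (!i) x o = N.opD (!i) y o := congrArg Subtype.val hxy.2
      have hx'' := hx' (!i)
      change N.opD (!i) x o ∈ G at hx''
      change N.opD (!i) y o ∈ G
      rwa [← this]
  · change θ (factorProj hN o i N.filter _) (factorProj hN o i N.filter _)
    rwa [factorProj_coe, factorProj_coe]
  · exact Subtype.ext ((hnot a).trans (hnot b).symm)

end Factor

lemma prodLogic_hasTheorems (hl : ∀ i, (l i).HasTheorems) : (prodLogic l).HasTheorems := by
  choose t ht using fun i => (hl i).exists_unary
  refine ⟨.func (L := (prodLogic l).lang) t fun _ => .var ⟨true, none⟩, ?_⟩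
  rintro _ ⟨P, hP, rfl⟩ w - i
  exact ht i (P i) (hP i) _

/-- `e` decomposes the matrix `N`, in the language of a product, as the non-indexed product of
Suszko reduced models `P i` of the factors. -/
structure IsDecomposition (N : LMatrix.{u} (prodLogic l).lang)
    (P : ∀ i, LMatrix.{u} (l i).lang) (e : N.carrier → ∀ i, (P i).carrier) : Prop where
  mem : ∀ i, P i ∈ ModSuszko (l i)
  bijective : Function.Bijective e
  funMap : ∀ (n : ℕ) (s : ∀ i, (l i).lang.Term (Fin n)) (a : Fin n → N.carrier) (i : Bool),
    e (Structure.funMap (L := (prodLogic l).lang) s a) i = (s i).realize fun k => e (a k) i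
  filter : ∀ x, x ∈ N.filter ↔ ∀ i, e x i ∈ (P i).filter

namespace IsDecomposition

variable {N : LMatrix.{u} (prodLogic l).lang} {P : ∀ i, LMatrix.{u} (l i).lang}
  {e : N.carrier → ∀ i, (P i).carrier} (h : IsDecomposition N P e)
include h

lemma surjective (i : Bool) : Function.Surjective fun x => e x i := fun c => by
  obtain ⟨x, hx⟩ := h.bijective.2 (Function.update (fun j => (P j).nonempty.some) i c)
  exact ⟨x, by simp [hx]⟩

/-- Polynomials of a factor lift to polynomials of the product. -/
lemma exists_poly_lift (i : Bool) {p : (P i).carrier → (P i).carrier} (hp : (P i).IsPoly p) :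
    ∃ q, N.IsPoly q ∧ ∀ x, e (q x) i = p (e x i) := by
  have hhom : (N.translate (l i).algebraic
      fun _ f => Functions.term (liftSymbol i f.term)).IsHom (P i) fun x => e x i := by
    intro n f a
    refine (h.funMap n (liftSymbol i f.term) a i).trans ?_
    rw [liftSymbol_self]
    rfl
  obtain ⟨q, hq, hqp⟩ := hhom.exists_poly_lift (h.surjective i) hp
  exact ⟨q, hq.of_translate, hqp⟩

end IsDecomposition

/-- Suszko reduced models of a product of logics with theorems are products of Suszko reduced
models of the factors. -/
theorem exists_decomposition (hl : ∀ i, (l i).HasTheorems) {N : LMatrix.{u} (prodLogic l).lang}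
    (hN : N ∈ ModSuszko (prodLogic l)) : ∃ P e, IsDecomposition N P e := by
  obtain ⟨t, ht⟩ := (prodLogic_hasTheorems hl).exists_unary
  have ho := ht N hN.1 fun _ => N.nonempty.some
  set o := t.realize fun _ => N.nonempty.some
  refine ⟨fun i => factor hN o i N.filter, fun x i => factorProj hN o i N.filter x,
    fun i => factor_mem_modSuszko hN o i ho, ⟨fun x y hxy => ?_, fun f => ?_⟩,
    fun n s a i => factorProj_funMap hN o i N.filter s a, fun x => mem_filter_iff_opD hN.1 ho x⟩
  · exact opD_ext hN fun i => congrArg Subtype.val (congrFun hxy i)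
  · refine ⟨N.opD true (f true).1 (f false).1, funext fun i => Subtype.ext ?_⟩
    change N.opD i _ o = _
    cases i
    · rw [show N.opD true (f true).1 (f false).1 = N.opD false (f false).1 (f true).1 from
        opD_not hN false _ _, opD_left hN]
      exact (f false).2
    · rw [opD_left hN]
      exact (f true).2

/-- The product is a lower bound of its factors. -/
lemma prodLogic_le (i : Bool) : prodLogic l ≤ l i := by
  refine Logic.le_of_covers (fun n s => (s : ∀ i, (l i).lang.Term (Fin n)) i)
    (fun n f => ⟨liftSymbol i f.term, liftSymbol_self i _⟩) fun M hM => ?_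
  -- `M` is the product of itself with a trivial matrix
  let triv : ∀ i, LMatrix.{u} (l i).lang := fun i =>
    { carrier := PUnit
      nonempty := ⟨⟨⟩⟩
      str := { funMap := fun _ _ => ⟨⟩, RelMap := fun {n} R _ => ((l i).algebraic n).elim R }
      filter := Set.univ }
  have htriv : ∀ i, triv i ∈ Mod (l i) := fun i _ _ _ _ _ => trivial
  have hsub := (inducedLogic_inducedBy _ _ _ _ _ _ :
    (prodLogic l).InducedBy {N | ∃ P : ∀ i, LMatrix.{u} (l i).lang,
      (∀ i, P i ∈ Mod (l i)) ∧ N = prodMatrix P}).subset_mod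
  cases i
  · let P : ∀ i, LMatrix.{u} (l i).lang := fun i => match i with
      | true => triv true
      | false => M
    have hP : ∀ i, P i ∈ Mod (l i) := fun i => match i with
      | true => htriv true
      | false => hM
    refine LMatrix.IsHom.mem_mod (N := prodMatrix P) (h := fun x i => match i with
      | true => PUnit.unit
      | false => x) ?_ (fun x => ?_) (hsub ⟨P, hP, rfl⟩)
    · intro n s a
      funext i
      cases i <;> rfl
    · exact ⟨fun hx i => match i with
        | true => trivial
        | false => hx, fun h => h false⟩
  · let P : ∀ i, LMatrix.{u} (l i).lang := fun i => match i with
      | true => M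
      | false => triv false
    have hP : ∀ i, P i ∈ Mod (l i) := fun i => match i with
      | true => hM
      | false => htriv false
    refine LMatrix.IsHom.mem_mod (N := prodMatrix P) (h := fun x i => match i with
      | true => x
      | false => PUnit.unit) ?_ (fun x => ?_) (hsub ⟨P, hP, rfl⟩)
    · intro n s a
      funext i
      cases i <;> rfl
    · exact ⟨fun hx i => match i with
        | true => hx
        | false => trivial, fun h => h true⟩

/-- The product of logics with theorems is their greatest lower bound. -/
lemma le_prodLogic (hl : ∀ i, (l i).HasTheorems) {k : Logic.{u}} (h : ∀ i, k ≤ l i) :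
    k ≤ prodLogic l := by
  choose τ hτ using h
  let σ : Translation k.lang (prodLogic l).lang := fun n f =>
    Functions.term (L := (prodLogic l).lang) fun i => τ i n f
  refine ⟨σ, fun N hN => ?_⟩
  obtain ⟨P, e, hd⟩ := exists_decomposition hl hN
  have hhom : ∀ i, (N.translate k.algebraic σ).IsHom ((P i).translate k.algebraic (τ i))
      fun x => e x i := fun i n f a => hd.funMap n (fun i => τ i n f) a i
  constructor
  · intro Γ φ hφ v hv
    refine (hd.filter _).2 fun i => ?_
    have := (hτ i _ (hd.mem i)).1 Γ φ hφ (fun x => e (v x) i) fun γ hγ => ?_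
    · rwa [← (hhom i).realize] at this
    · rw [← (hhom i).realize]
      exact (hd.filter _).1 (hv γ hγ) i
  · intro a b hab
    refine hd.bijective.1 (funext fun i => (hτ i _ (hd.mem i)).2 _ _ fun G hG hGm => ?_)
    -- the preimage of a filter of the `i`-th factor is a filter
    let G' : Set N.carrier := {x | e x i ∈ G}
    have hhom' : ((N.translate k.algebraic σ).withFilter G').IsHom
      (((P i).translate k.algebraic (τ i)).withFilter G) fun x => e x i := hhom i
    refine (hhom'.leibniz_iff (hd.surjective i) fun _ => Iff.rfl).1 (hab G' ?_ ?_)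
    · exact fun x hx => hG ((hd.filter x).1 hx i)
    · exact hhom'.mem_mod (fun _ => Iff.rfl) hGm

end Product

/-! ### Criteria for protoalgebraicity -/

section Criterion

variable {l : Logic.{u}}

/-- The instances `p(x), p(y)` of a polynomial can be written with formulas, where `x` and `y` are
given variables. -/
lemma exists_formula_of_isPoly {M : LMatrix.{u} l.lang} {p : M.carrier → M.carrier}
    (hp : M.IsPoly p) {x y : l.Var} (hxy : x ≠ y) (a b : M.carrier) [DecidableEq l.Var] :
    ∃ (φ : l.Fm) (v : l.Var → M.carrier), v x = a ∧ v y = b ∧ φ.realize v = p a ∧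
      (φ.relabel fun z => if z = x then y else z).realize v = p b := by
  obtain ⟨t, ht⟩ := hp.exists_term
  obtain ⟨S, hS, hSt⟩ := term_exists_support (Z := M.carrier) t
  have := l.infinite
  have hinf : ({x, y}ᶜ : Set l.Var).Infinite := (Set.toFinite _).infinite_compl
  have hSf : (some ⁻¹' S).Finite := hS.preimage (Option.some_injective _).injOn
  obtain ⟨f, hfS, hf⟩ := hSf.exists_injOn_of_encard_le (t := ({x, y}ᶜ : Set l.Var))
    (by rw [hinf.encard_eq]; exact le_top)
  have := M.nonempty
  let v : l.Var → M.carrier := fun z =>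
    if z = x then a else if z = y then b else Function.invFunOn f (some ⁻¹' S) z
  have hv : ∀ c, some c ∈ S → f c ≠ x ∧ v (f c) = c := fun c hc => by
    have hfc := hfS hc
    simp only [Set.mem_preimage, Set.mem_compl_iff, Set.mem_insert_iff, Set.mem_singleton_iff,
      not_or] at hfc
    exact ⟨hfc.1, by simp only [v, hfc.1, hfc.2, if_false]; exact hf.leftInvOn_invFunOn hc⟩
  have hreal : ∀ w w' : Option M.carrier → M.carrier, Set.EqOn w w' S →
      t.realize w = t.realize w' := fun w w' h => by
    have := congrArg (Term.realize (fun c : M.carrier => c)) (hSt w w' h)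
    simpa [Term.realize_relabel, Function.comp_def] using this
  refine ⟨t.relabel fun o => o.elim x f, v, by simp [v], by simp [v, hxy.symm], ?_, ?_⟩
  · rw [Term.realize_relabel, ht]
    refine hreal _ _ fun o ho => ?_
    cases o with
    | none => simp [v]
    | some c => exact (hv c ho).2
  · rw [Term.relabel_relabel, Term.realize_relabel, ht]
    refine hreal _ _ fun o ho => ?_
    cases o with
    | none => simp [v, hxy.symm]
    | some c => simpa [(hv c ho).1] using (hv c ho).2

/-- A logic is protoalgebraic if reflexive binary terms, applied to all values of unary
polynomials, separate the elements of its Suszko reduced models. -/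
theorem isProtoalgebraic_of_separating (D : Set (l.lang.Term (Fin 2))) (hne : D.Nonempty)
    (hrefl : ∀ M ∈ ModSuszko l, ∀ a, ∀ δ ∈ D, δ.realize ![a, a] ∈ M.filter)
    (hsep : ∀ M ∈ ModSuszko l, ∀ a b, (∀ δ ∈ D, ∀ p, M.IsPoly p →
      δ.realize ![p a, p b] ∈ M.filter ∧ δ.realize ![p b, p a] ∈ M.filter) → a = b) :
    l.IsProtoalgebraic := by
  classical
  have := l.infinite
  obtain ⟨x, y, hxy⟩ := exists_pair_ne l.Var
  let sub : l.Fm → l.Fm := fun φ => φ.relabel fun z => if z = x then y else z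
  have hvec : ∀ {M : LMatrix.{u} l.lang} (δ : l.lang.Term (Fin 2)) (φ ψ : l.Fm)
      (v : l.Var → M.carrier), (δ.subst ![φ, ψ]).realize v =
        δ.realize ![φ.realize v, ψ.realize v] := fun δ φ ψ v => by
    rw [Term.realize_subst]
    congr 1
    funext i
    fin_cases i <;> rfl
  have hmap : ∀ {M N : LMatrix.{u} l.lang} {f : M.carrier → N.carrier}, M.IsHom N f →
      ∀ (δ : l.lang.Term (Fin 2)) (c d : M.carrier),
        δ.realize ![f c, f d] = f (δ.realize ![c, d]) := fun hf δ c d => by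
    rw [hf.realize]
    congr 1
    funext i
    fin_cases i <;> rfl
  refine ⟨x, y, {χ | ∃ δ ∈ D, ∃ φ, χ = δ.subst ![φ, sub φ] ∨ χ = δ.subst ![sub φ, φ]}, hxy, ?_,
    fun M hM a b => ⟨?_, ?_⟩⟩
  · obtain ⟨δ, hδ⟩ := hne
    exact ⟨_, δ, hδ, .var x, .inl rfl⟩
  · rintro hab v rfl rfl _ ⟨δ, hδ, φ, h⟩
    -- the polynomial given by `φ` in the variable `x`
    let q : M.carrier → M.carrier := fun c => φ.realize (Function.update v x c)
    have hq : M.IsPoly q := .term φ (fun z c => Function.update v x c z) fun z => by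
      by_cases hz : z = x
      · subst hz; simpa using .id
      · simpa [hz] using .const _
    have hq₁ : φ.realize v = q (v x) := by simp [q]
    have hq₂ : (sub φ).realize v = q (v y) := by
      rw [Term.realize_relabel]
      change _ = φ.realize _
      congr 1
      funext z
      by_cases hz : z = x
      · subst hz; simp
      · simp [hz]
    have hpoly : ∀ s : Fin 2 → M.carrier → M.carrier, (∀ i, M.IsPoly (s i)) →
        (δ.realize fun i => s i (v x)) ∈ M.filter → (δ.realize fun i => s i (v y)) ∈ M.filter :=
      fun s hs => (LMatrix.leibniz_iff.1 hab _ (.term δ s hs)).1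
    have h₀ : δ.realize ![q (v x), q (v x)] ∈ M.filter := by
      obtain ⟨N, f, hN, hh, -, hF, -⟩ := exists_reduction hM
      rw [hF, ← hmap hh]
      exact hrefl N hN _ δ hδ
    rcases h with rfl | rfl <;> rw [hvec, hq₁, hq₂]
    · have := hpoly ![fun _ => q (v x), q] (by
        intro i; fin_cases i
        · exact .const _
        · exact hq) (by convert h₀ using 2; funext i; fin_cases i <;> rfl)
      convert this using 2; funext i; fin_cases i <;> rfl
    · have := hpoly ![q, fun _ => q (v x)] (by
        intro i; fin_cases i
        · exact hq
        · exact .const _) (by convert h₀ using 2; funext i; fin_cases i <;> rfl)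
      convert this using 2; funext i; fin_cases i <;> rfl
  · intro h
    have hM' : ∀ δ ∈ D, ∀ p, M.IsPoly p →
        δ.realize ![p a, p b] ∈ M.filter ∧ δ.realize ![p b, p a] ∈ M.filter := by
      intro δ hδ p hp
      obtain ⟨φ, v, hx, hy, h₁, h₂⟩ := exists_formula_of_isPoly hp hxy a b
      have h₃ := h v hx hy _ ⟨δ, hδ, φ, .inl rfl⟩
      have h₄ := h v hx hy _ ⟨δ, hδ, φ, .inr rfl⟩
      rw [hvec] at h₃ h₄
      rw [← h₁, ← h₂]
      exact ⟨h₃, h₄⟩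
    obtain ⟨N, f, hN, hh, hs, hF, hker⟩ := exists_reduction hM
    refine hker a b (hsep N hN _ _ fun δ hδ p hp => ?_) M.filter subset_rfl hM
    obtain ⟨q, hq, hqp⟩ := hh.exists_poly_lift hs hp
    rw [← hqp, ← hqp, hmap hh, hmap hh, ← hF, ← hF]
    exact hM' δ hδ q hq

/-- In models of a protoalgebraic logic, the reflexive binary terms satisfy modus ponens. -/
lemma Logic.IsProtoalgebraic.exists_modus_ponens (hl : l.IsProtoalgebraic) :
    ∃ D : Set (l.lang.Term (Fin 2)), D.Nonempty ∧
      (∀ M ∈ Mod l, ∀ a, ∀ δ ∈ D, δ.realize ![a, a] ∈ M.filter) ∧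
      ∀ M ∈ Mod l, ∀ a b, a ∈ M.filter → (∀ δ ∈ D, δ.realize ![a, b] ∈ M.filter) →
        b ∈ M.filter := by
  classical
  obtain ⟨x, y, Δ, hxy, ⟨δ, hδ⟩, hΔ⟩ := hl
  let r : l.Var → Fin 2 := fun z => if z = y then 1 else 0
  have hconst : ∀ {M : LMatrix.{u} l.lang} (a : M.carrier) (φ : l.Fm),
      (φ.relabel r).realize ![a, a] = φ.realize fun _ => a := fun a φ => by
    rw [Term.realize_relabel]
    congr 1
    funext z
    by_cases hz : z = y <;> simp [r, hz]
  refine ⟨{δ | ∀ M ∈ Mod l, ∀ a, δ.realize ![a, a] ∈ M.filter}, ⟨δ.relabel r, fun M hM a => ?_⟩,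
    fun M hM a δ hδ => hδ M hM a, fun M hM a b ha h => ?_⟩
  · rw [hconst]
    exact (hΔ M hM a a).1 .rfl _ rfl rfl δ hδ
  -- the least theory making `x` and `y` indistinguishable, and its extension by `x`
  let T₀ : Set l.Fm := {φ | ∀ M ∈ Mod l, ∀ v, v x = v y → φ.realize v ∈ M.filter}
  let T₁ : Set l.Fm := {φ | ∀ M ∈ Mod l, ∀ v : l.Var → M.carrier,
    ((∀ ψ ∈ T₀, ψ.realize v ∈ M.filter) ∧ v x ∈ M.filter) → φ.realize v ∈ M.filter}
  have h₁ : l.fmMatrix T₁ ∈ Mod l := fmMatrix_mem_mod_of_assignments l _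
  have hxy₁ : (l.fmMatrix T₁).Leibniz (.var x : l.Fm) (.var y : l.Fm) := by
    refine (hΔ _ h₁ _ _).2 fun (w : l.Var → l.Fm) hx hy δ hδ =>
      (realize_mem_fmMatrix_iff δ w).2 ?_
    intro N hN v hv
    refine hv.1 _ fun N' hN' v' hv' => ?_
    rw [Term.realize_subst]
    refine (hΔ N' hN' (v' x) (v' x)).1 .rfl _ ?_ ?_ δ hδ
    · exact congrArg (Term.realize v') hx
    · exact (congrArg (Term.realize v') hy).trans hv'.symm
  have hy : (.var y : l.Fm) ∈ T₁ :=
    hxy₁.mem (show (.var x : l.Fm) ∈ T₁ from fun _ _ _ hv => hv.2)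
  have := hy M hM (fun z => if z = y then b else a) ⟨fun ψ hψ => ?_, by simpa [hxy] using ha⟩
  · simpa using this
  · have := h (ψ.relabel r) fun N hN c => by
      rw [hconst]
      exact hψ N hN _ rfl
    rw [Term.realize_relabel] at this
    convert this using 2
    funext z
    by_cases hz : z = y <;> simp [r, hz]

end Criterion

/-! ### Leibniz conditions for protoalgebraic and for assertional logics -/

/-- Function symbols of an ample language: `I`-many basic operations of every positive arity,
`I`-many binary implications and a unary symbol. -/
inductive AmpleSymbol (I : Type u) : ℕ → Type u
  | op {n : ℕ} (i : I) : AmpleSymbol I (n + 1)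
  | imp (i : I) : AmpleSymbol I 2
  | top : AmpleSymbol I 1

/-- The ample language over `I`. The same language serves for the protoalgebraic condition, which puts
no constraint on `top`, and for the assertional one, which puts none on the implications. -/
def ampleLang (I : Type u) : FirstOrder.Language.{u, 0} := ⟨AmpleSymbol I, fun _ => Empty⟩

section Ample

variable {I J : Type u}

/-- The value of the `i`-th implication. -/
def LMatrix.imp (M : LMatrix.{u} (ampleLang I)) (i : I) (a b : M.carrier) : M.carrier :=
  Structure.funMap (L := ampleLang I) (AmpleSymbol.imp i) ![a, b]

/-- The value of the unary symbol `top`. -/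
def LMatrix.top (M : LMatrix.{u} (ampleLang I)) (a : M.carrier) : M.carrier :=
  Structure.funMap (L := ampleLang I) AmpleSymbol.top ![a]

variable (I) in
/-- Matrices whose implications are reflexive and satisfy modus ponens. -/
def protoMatrices : Set (LMatrix.{u} (ampleLang I)) :=
  {M | (∀ i a, M.imp i a a ∈ M.filter) ∧
    ∀ a b, a ∈ M.filter → (∀ i, M.imp i a b ∈ M.filter) → b ∈ M.filter}

variable (I) in
/-- Matrices whose filter contains all values of `top` and is a block of the Leibniz congruence. -/
def asrtMatrices : Set (LMatrix.{u} (ampleLang I)) :=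
  {M | (∀ a, M.top a ∈ M.filter) ∧ ∀ a b, a ∈ M.filter → b ∈ M.filter → M.Leibniz a b}

variable (I) in
/-- The logic in countably many variables induced by a class of matrices for the ample language. -/
def ampleLogic (K : Set (LMatrix.{u} (ampleLang I))) : Logic.{u} :=
  inducedLogic (ampleLang I) (fun _ => inferInstanceAs (IsEmpty Empty)) ⟨fun f => nomatch f⟩
    (ULift.{u} ℕ) inferInstance K

variable (I) in
/-- The basic protoalgebraic logic over `I`. -/
abbrev protoLogic : Logic.{u} := ampleLogic I (protoMatrices I)

variable (I) in
/-- The basic assertional logic over `I`. -/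
abbrev asrtLogic : Logic.{u} := ampleLogic I (asrtMatrices I)

lemma realize_imp {M : LMatrix.{u} (ampleLang I)} {Y : Type*} (w : Y → M.carrier) (i : I)
    (s t : (ampleLang I).Term Y) :
    (Functions.apply₂ (L := ampleLang I) (AmpleSymbol.imp i) s t).realize w =
      M.imp i (s.realize w) (t.realize w) :=
  Term.realize_functions_apply₂

lemma ampleLogic_inducedBy (K : Set (LMatrix.{u} (ampleLang I))) :
    (ampleLogic I K).InducedBy K := fun _ _ => Iff.rfl

lemma mod_protoLogic : Mod (protoLogic I) = protoMatrices I := by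
  refine Set.Subset.antisymm (fun (M : LMatrix.{u} (ampleLang I)) hM =>
    ⟨fun i a => ?_, fun a b ha hab => ?_⟩)
    (ampleLogic_inducedBy _).subset_mod
  · have := (ampleLogic_inducedBy (protoMatrices I)).rule_of_finite hM
      (Y := PUnit.{u + 1}) (Γ := ∅) Set.finite_empty
      (φ := Functions.apply₂ (L := ampleLang I) (AmpleSymbol.imp i) (.var ⟨⟩) (.var ⟨⟩))
      (fun N hN w _ => by
        have := hN.1 i (w ⟨⟩)
        exact (iff_of_eq (congrArg (· ∈ N.filter) (realize_imp w i _ _))).2 this)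
      (fun _ => a) (fun _ h => h.elim)
    exact (iff_of_eq (congrArg (· ∈ M.filter) (realize_imp (M := M) (fun _ => a) i _ _))).1 this
  · have hf : Function.Injective fun k : Fin 2 => (⟨k.1⟩ : ULift.{u} ℕ) := fun k m h => by
      simpa [Fin.ext_iff] using h
    have hr : ∀ (N : LMatrix.{u} (ampleLang I)) (w : Fin 2 → N.carrier) (i : I),
        Term.realize w (Functions.apply₂ (L := ampleLang I) (AmpleSymbol.imp i) (.var 0) (.var 1))
          ∈ N.filter ↔ N.imp i (w 0) (w 1) ∈ N.filter := fun N w i =>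
      iff_of_eq (congrArg (· ∈ N.filter) (realize_imp w i _ _))
    refine (ampleLogic_inducedBy (protoMatrices I)).rule_of_injective hM hf
      (Γ := insert (.var 0) (Set.range fun i =>
        Functions.apply₂ (L := ampleLang I) (AmpleSymbol.imp i) (.var 0) (.var 1)))
      (φ := .var 1) (fun N hN w hw => ?_) ![a, b] ?_
    · exact hN.2 (w 0) (w 1) (hw _ (.inl rfl)) fun i => (hr N w i).1 (hw _ (.inr ⟨i, rfl⟩))
    · rintro _ (rfl | ⟨i, rfl⟩)
      · exact ha
      · exact (hr M ![a, b] i).2 (hab i)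

lemma mod_asrtLogic : Mod (asrtLogic I) = asrtMatrices I := by
  refine Set.Subset.antisymm (fun (M : LMatrix.{u} (ampleLang I)) hM =>
    ⟨fun a => ?_, fun a b ha hb => ?_⟩)
    (ampleLogic_inducedBy _).subset_mod
  · have hr : ∀ (N : LMatrix.{u} (ampleLang I)) (w : PUnit.{u + 1} → N.carrier),
        Term.realize w (Functions.apply₁ (L := ampleLang I) AmpleSymbol.top (.var ⟨⟩))
          ∈ N.filter ↔ N.top (w ⟨⟩) ∈ N.filter := fun N w =>
      iff_of_eq (congrArg (· ∈ N.filter) Term.realize_functions_apply₁)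
    exact (hr M fun _ => a).1 ((ampleLogic_inducedBy (asrtMatrices I)).rule_of_finite hM
      (Γ := ∅) Set.finite_empty
      (φ := Functions.apply₁ (L := ampleLang I) AmpleSymbol.top (.var PUnit.unit.{u + 1}))
      (fun N hN w _ => (hr N w).2 (hN.1 _)) (fun _ => a) (fun _ h => h.elim))
  · -- the rules `x, y, p(x) ⊢ p(y)`
    have key : ∀ a ∈ M.filter, ∀ b ∈ M.filter, ∀ p, M.IsPoly p → p a ∈ M.filter →
        p b ∈ M.filter := by
      intro a ha b hb p hp hpa
      obtain ⟨t, ht⟩ := hp.exists_term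
      let plug : M.carrier → (ampleLang I).Term M.carrier := fun c =>
        t.relabel fun o => o.elim c id
      have hplug : ∀ c, Term.realize id (plug c) = p c := fun c => by
        rw [ht, Term.realize_relabel]; rfl
      rw [← hplug] at hpa ⊢
      refine (ampleLogic_inducedBy (asrtMatrices I)).rule_of_finite hM
        (Γ := {.var a, .var b, plug a})
        (((Set.finite_singleton _).insert _).insert _) (φ := plug b)
        (fun (N : LMatrix.{u} (ampleLang I)) hN w hw => ?_) id ?_
      · have ha' := hw _ (.inl rfl)
        have hb' := hw _ (.inr (.inl rfl))
        have hp' := hw _ (.inr (.inr rfl))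
        have hL := LMatrix.leibniz_iff.1 (hN.2 _ _ ha' hb')
        let g : Option M.carrier → N.carrier → N.carrier := fun o x => o.elim x w
        have hg : ∀ o, N.IsPoly (g o) := fun o => by
          cases o
          · exact .id
          · exact .const _
        have hrel : ∀ c, Term.realize w (plug c) = t.realize fun o => g o (w c) := fun c => by
          rw [Term.realize_relabel]
          congr 1
          funext o
          cases o <;> rfl
        have hp'' : (t.realize fun o => g o (w a)) ∈ N.filter := by
          rw [← hrel]; exact hp'
        have := (hL _ (.term t g hg)).1 hp''
        exact (iff_of_eq (congrArg (· ∈ N.filter) (hrel b))).2 this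
      · rintro _ (rfl | rfl | rfl)
        · exact ha
        · exact hb
        · exact hpa
    exact LMatrix.leibniz_iff.2 fun p hp => ⟨key a ha b hb p hp, key b hb a ha p hp⟩

/-- The translation of an ample language given by an enumeration of the symbols of the target
language, and by terms for the implications and for `top`. -/
def ampleTranslation {L : FirstOrder.Language.{u, 0}} (g : ∀ n, I → Option (L.Functions n))
    (d : I → L.Term (Fin 2)) (t : L.Term (Fin 1)) : Translation (ampleLang I) L
  | _, .op (n := n) i => (g (n + 1) i).elim (.var 0) Functions.term
  | _, .imp i => d i
  | _, .top => t

/-- Interpretations of logics in ample languages: it suffices to reach all basic operations. -/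
lemma ampleLogic_le {K : Set (LMatrix.{u} (ampleLang I))} {l : Logic.{u}}
    {g : ∀ n, I → Option (l.lang.Functions n)} (hg : ∀ n f, ∃ i, g n i = some f)
    (d : I → l.lang.Term (Fin 2)) (t : l.lang.Term (Fin 1))
    (h : ∀ M ∈ Mod l,
      M.translate (fun _ => inferInstanceAs (IsEmpty Empty)) (ampleTranslation g d t) ∈ K) :
    ampleLogic I K ≤ l := by
  refine Logic.le_of_covers (ampleTranslation g d t) (fun n f => ?_)
    fun M hM => (ampleLogic_inducedBy K).subset_mod (h M hM)
  rcases n with _ | n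
  · exact (l.noConstants.elim f)
  · obtain ⟨i, hi⟩ := hg _ f
    exact ⟨AmpleSymbol.op i, by simp [ampleTranslation, hi]⟩

/-- The symbols of each arity can be enumerated by a large enough index set. The value `none` takes
care of arities without symbols. -/
lemma exists_enumeration {X : ℕ → Type u} (e : (Σ n, X n) ↪ I) :
    ∃ g : ∀ n, I → Option (X n), ∀ n f, ∃ i, g n i = some f := by
  classical
  refine ⟨fun n => Function.partialInv fun f => e ⟨n, f⟩, fun n f => ⟨e ⟨n, f⟩, ?_⟩⟩
  exact Function.partialInv_left (f := fun f : X n => e ⟨n, f⟩)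
    (fun a b h => by simpa using e.injective h) f

lemma ampleLogic_mono {K : Set (LMatrix.{u} (ampleLang I))} {K' : Set (LMatrix.{u} (ampleLang J))}
    {s : I → J} (hs : Function.Surjective s)
    (h : ∀ M ∈ Mod (ampleLogic J K'), M.translate (fun _ => inferInstanceAs (IsEmpty Empty))
      (fun (n : ℕ) (f : AmpleSymbol I n) => (match n, f with
        | _, .op i => Functions.term (L := ampleLang J) (AmpleSymbol.op (s i))
        | _, .imp i => Functions.term (L := ampleLang J) (AmpleSymbol.imp (s i))
        | _, .top => Functions.term (L := ampleLang J) AmpleSymbol.top)) ∈ K) :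
    ampleLogic I K ≤ ampleLogic J K' := by
  refine Logic.le_of_covers _ (fun n f => ?_) fun M hM =>
    (ampleLogic_inducedBy K).subset_mod (h M hM)
  cases f with
  | op j =>
    obtain ⟨i, rfl⟩ := hs j
    exact ⟨AmpleSymbol.op i, rfl⟩
  | imp j =>
    obtain ⟨i, rfl⟩ := hs j
    exact ⟨AmpleSymbol.imp i, rfl⟩
  | top => exact ⟨AmpleSymbol.top, rfl⟩

lemma protoLogic_mono {s : I → J} (hs : Function.Surjective s) : protoLogic I ≤ protoLogic J := by
  refine ampleLogic_mono hs fun M hM => ?_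
  rw [mod_protoLogic] at hM
  refine ⟨fun i a => hM.1 (s i) a, fun a b ha h => hM.2 a b ha fun j => ?_⟩
  obtain ⟨i, rfl⟩ := hs j
  exact h i

lemma asrtLogic_mono {s : I → J} (hs : Function.Surjective s) : asrtLogic I ≤ asrtLogic J := by
  refine ampleLogic_mono hs fun M hM => ?_
  rw [mod_asrtLogic] at hM
  exact ⟨fun a => hM.1 a, fun a b ha hb => (hM.2 a b ha hb).translate⟩

lemma protoLogic_hasTheorems [Nonempty I] : (protoLogic I).HasTheorems :=
  ⟨Functions.apply₂ (L := ampleLang I) (AmpleSymbol.imp (Classical.arbitrary I)) (.var ⟨0⟩)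
    (.var ⟨0⟩), fun M hM w _ => by
      have := hM.1 (Classical.arbitrary I) (w ⟨0⟩)
      exact (iff_of_eq (congrArg (· ∈ M.filter) (realize_imp (M := M) w _ _ _))).2 this⟩

lemma asrtLogic_hasTheorems : (asrtLogic I).HasTheorems :=
  ⟨Functions.apply₁ (L := ampleLang I) AmpleSymbol.top (.var ⟨0⟩), fun M hM w _ => by
    have := hM.1 (w ⟨0⟩)
    exact (iff_of_eq (congrArg (· ∈ M.filter) Term.realize_functions_apply₁)).2 this⟩

/-- In models of the basic protoalgebraic logic, elements are identified by the Suszko congruence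
as soon as the implications between their images under all unary polynomials hold. -/
lemma eq_of_imp {M : LMatrix.{u} (ampleLang I)} (hM : M ∈ ModSuszko (protoLogic I))
    {a b : M.carrier} (h : ∀ i p, M.IsPoly p →
      M.imp i (p a) (p b) ∈ M.filter ∧ M.imp i (p b) (p a) ∈ M.filter) : a = b := by
  refine hM.2 a b fun G hG hGm => LMatrix.leibniz_withFilter_iff.2 fun p hp => ?_
  rw [mod_protoLogic] at hGm
  exact ⟨fun ha => hGm.2 _ _ ha fun i => hG (h i p hp).1,
    fun hb => hGm.2 _ _ hb fun i => hG (h i p hp).2⟩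

lemma Logic.IsProtoalgebraic.of_protoLogic_le [Nonempty I] {l : Logic.{u}}
    (h : protoLogic I ≤ l) : l.IsProtoalgebraic := by
  obtain ⟨τ, hτ⟩ := h
  refine isProtoalgebraic_of_separating (Set.range fun i => τ 2 (AmpleSymbol.imp i))
    (Set.range_nonempty _) ?_ fun M hM a b hab => ?_
  · rintro M hM a _ ⟨i, rfl⟩
    have := (hτ M hM).1
    rw [mod_protoLogic] at this
    exact this.1 i a
  · exact eq_of_imp (hτ M hM) fun i p hp => hab _ ⟨i, rfl⟩ p hp.of_translate

lemma Logic.IsAssertional.of_asrtLogic_le {l : Logic.{u}} (h : asrtLogic I ≤ l) :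
    l.IsAssertional := by
  obtain ⟨τ, hτ⟩ := h
  intro M hM
  have hM' := hτ M hM
  have hmod := hM'.1
  rw [mod_asrtLogic] at hmod
  obtain ⟨c⟩ := M.nonempty
  refine ⟨_, Set.eq_singleton_iff_unique_mem.2 ⟨hmod.1 c, fun a ha => hM'.2 _ _ fun G hG hGm => ?_⟩⟩
  rw [mod_asrtLogic] at hGm
  exact hGm.2 _ _ (hG ha) (hG (hmod.1 c))

end Ample

/-- The index set of the ample language attached to an ordinal. One element is added to make it
nonempty: protoalgebraicity requires a nonempty set of implications. -/
abbrev ampleIndex (α : Ordinal.{u}) : Type u := Option α.ToType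

lemma ampleIndex_surjective {α β : Ordinal.{u}} (h : α ≤ β) :
    ∃ s : ampleIndex β → ampleIndex α, Function.Surjective s := by
  obtain ⟨e⟩ : Nonempty (α.ToType ↪ β.ToType) := by
    rw [← Cardinal.le_def]
    simpa using Ordinal.card_le_card h
  exact ⟨Function.invFun e.optionMap, Function.invFun_surjective e.optionMap.injective⟩

lemma exists_embedding_ampleIndex (X : Type u) :
    ∃ α : Ordinal.{u}, Nonempty (X ↪ ampleIndex α) := by
  refine ⟨(Cardinal.mk X).ord, ?_⟩
  obtain ⟨e⟩ := Cardinal.eq.1 (Cardinal.mk_ord_toType (Cardinal.mk X)).symm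
  exact ⟨e.toEmbedding.trans Function.Embedding.some⟩

/-- Protoalgebraicity is the Leibniz condition given by the basic protoalgebraic logics. -/
theorem isProtoalgebraic_iff {l : Logic.{u}} :
    l.IsProtoalgebraic ↔ ∃ α : Ordinal.{u}, protoLogic (ampleIndex α) ≤ l := by
  refine ⟨fun hl => ?_, fun ⟨α, h⟩ => .of_protoLogic_le h⟩
  obtain ⟨D, ⟨δ₀, hδ₀⟩, hrefl, hmp⟩ := hl.exists_modus_ponens
  obtain ⟨α, ⟨e⟩⟩ := exists_embedding_ampleIndex ((Σ n, l.lang.Functions n) ⊕ D)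
  obtain ⟨g, hg⟩ := exists_enumeration (Function.Embedding.inl.trans e)
  have : Nonempty D := ⟨⟨δ₀, hδ₀⟩⟩
  have hd := Function.invFun_surjective (Function.Embedding.inr.trans e).injective
  set d := Function.invFun (Function.Embedding.inr.trans e)
  refine ⟨α, ampleLogic_le hg (fun i => (d i).1) (.var 0) fun M hM => ?_⟩
  refine ⟨fun i a => hrefl M hM a _ (d i).2, fun a b ha h => hmp M hM a b ha fun δ hδ => ?_⟩
  obtain ⟨i, hi⟩ := hd ⟨δ, hδ⟩
  have : Term.realize (M := M.carrier) ![a, b] (d i).1 ∈ M.filter := h i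
  rwa [hi] at this

/-- Being assertional is the Leibniz condition given by the basic assertional logics. -/
theorem isAssertional_iff {l : Logic.{u}} :
    l.IsAssertional ↔ ∃ α : Ordinal.{u}, asrtLogic (ampleIndex α) ≤ l := by
  refine ⟨fun hl => ?_, fun ⟨α, h⟩ => .of_asrtLogic_le h⟩
  obtain ⟨t, ht⟩ := (hasTheorems_of_filter_nonempty (l := l) fun M hM => by
    obtain ⟨a, ha⟩ := hl M hM
    exact ⟨a, ha ▸ rfl⟩).exists_unary
  obtain ⟨α, ⟨e⟩⟩ := exists_embedding_ampleIndex (Σ n, l.lang.Functions n)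
  obtain ⟨g, hg⟩ := exists_enumeration e
  refine ⟨α, ampleLogic_le hg (fun _ => .var 0) t fun M hM => ⟨fun a => ht M hM _, ?_⟩⟩
  intro a b ha hb
  obtain ⟨N, h, hN, -, -, hF, hker⟩ := exists_reduction hM
  obtain ⟨c, hc⟩ := hl N hN
  have ha' : h a = c := by simpa [hc] using (hF a).1 ha
  have hb' : h b = c := by simpa [hc] using (hF b).1 hb
  exact LMatrix.Leibniz.translate (hker a b (ha'.trans hb'.symm) M.filter subset_rfl hM)

lemma isLeibnizCondition_protoLogic :
    IsLeibnizCondition fun α : Ordinal.{u} => protoLogic (ampleIndex α) :=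
  fun _ _ h => let ⟨_, hs⟩ := ampleIndex_surjective h; protoLogic_mono hs

lemma isLeibnizCondition_asrtLogic :
    IsLeibnizCondition fun α : Ordinal.{u} => asrtLogic (ampleIndex α) :=
  fun _ _ h => let ⟨_, hs⟩ := ampleIndex_surjective h; asrtLogic_mono hs

/-! ### Boolean algebras with a subset containing the top element -/

/-- The term `s ⊓ t`. -/
def boolInf {Y : Type*} (s t : boolLang.{u}.Term Y) : boolLang.{u}.Term Y :=
  Functions.apply₂ (L := boolLang.{u}) BoolSymbol.inf s t

/-- The term `(s ⊓ t) ⊔ (sᶜ ⊓ tᶜ)`. -/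
def boolIff {Y : Type*} (s t : boolLang.{u}.Term Y) : boolLang.{u}.Term Y :=
  Functions.apply₂ (L := boolLang.{u}) BoolSymbol.sup (boolInf s t)
    (boolInf (Functions.apply₁ (L := boolLang.{u}) BoolSymbol.compl s)
      (Functions.apply₁ (L := boolLang.{u}) BoolSymbol.compl t))

lemma logicBAStar_inducedBy : logicBAStar.{u}.InducedBy boolMatrices := fun _ _ => Iff.rfl

lemma boolMatrices_induction {p : LMatrix.{u} boolLang.{u} → Prop}
    (h : ∀ (A : Type u) (hA : Nonempty A) (B : BooleanAlgebra A) (F : Set A), ⊤ ∈ F →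
      p ⟨A, hA, boolStructure A B, F⟩) : ∀ M ∈ boolMatrices.{u}, p M := by
  rintro M ⟨B, hB, htop⟩
  have hM : ⟨M.carrier, M.nonempty, boolStructure M.carrier B, M.filter⟩ = M := by rw [← hB]
  exact hM ▸ h M.carrier M.nonempty B M.filter htop

/-- The value of `x ⊓ y`. -/
def LMatrix.boolInf (M : LMatrix.{u} boolLang.{u}) (a b : M.carrier) : M.carrier :=
  Structure.funMap (L := boolLang.{u}) BoolSymbol.inf ![a, b]

/-- The value of `x ↔ y`. -/
def LMatrix.boolIff (M : LMatrix.{u} boolLang.{u}) (a b : M.carrier) : M.carrier :=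
  Structure.funMap (L := boolLang.{u}) BoolSymbol.sup ![M.boolInf a b,
    M.boolInf (Structure.funMap (L := boolLang.{u}) BoolSymbol.compl ![a])
      (Structure.funMap (L := boolLang.{u}) BoolSymbol.compl ![b])]

lemma realize_boolInf {M : LMatrix.{u} boolLang.{u}} {Y : Type*} (w : Y → M.carrier)
    (s t : boolLang.{u}.Term Y) :
    (boolInf s t).realize w = M.boolInf (s.realize w) (t.realize w) :=
  Term.realize_functions_apply₂

lemma realize_boolIff {M : LMatrix.{u} boolLang.{u}} {Y : Type*} (w : Y → M.carrier)
    (s t : boolLang.{u}.Term Y) :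
    (boolIff s t).realize w = M.boolIff (s.realize w) (t.realize w) :=
  Term.realize_functions_apply₂.trans <| congrArg₂
    (fun x y => Structure.funMap (L := boolLang.{u}) BoolSymbol.sup ![x, y])
    (realize_boolInf w s t) <| (realize_boolInf w _ _).trans <|
      congrArg₂ M.boolInf Term.realize_functions_apply₁ Term.realize_functions_apply₁

lemma boolIff_self_mem {M : LMatrix.{u} boolLang.{u}} (hM : M ∈ Mod logicBAStar.{u})
    (a : M.carrier) : M.boolIff a a ∈ M.filter := by
  have := logicBAStar_inducedBy.rule_of_finite hM (Γ := ∅) Set.finite_empty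
    (φ := boolIff (.var a) (.var a)) (boolMatrices_induction fun A _ B F htop w _ => by
      change (w a ⊓ w a) ⊔ ((w a)ᶜ ⊓ (w a)ᶜ) ∈ F
      simpa using htop) id (fun _ h => h.elim)
  exact (iff_of_eq (congrArg (· ∈ M.filter) (realize_boolIff (M := M) id (.var a) (.var a)))).1 this

/-- In Suszko reduced models, equality is expressed by `x ↔ y` having the value `x ↔ x`. -/
lemma eq_of_boolIff_eq {M : LMatrix.{u} boolLang.{u}} (hM : M ∈ ModSuszko logicBAStar.{u})
    {a b : M.carrier} (h : M.boolIff a b = M.boolIff a a) : a = b := by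
  have hE : ∀ x y z, Term.realize id (boolInf (.var x) (boolIff (.var y) (.var z))) =
      M.boolInf x (M.boolIff y z) := fun x y z => by
    rw [realize_boolInf, realize_boolIff]
    rfl
  have h₁ : M.boolInf a (M.boolIff a b) = M.boolInf b (M.boolIff a b) := by
    have := logicBAStar_inducedBy.realize_eq hM
      (s := boolInf (.var a) (boolIff (.var a) (.var b)))
      (t := boolInf (.var b) (boolIff (.var a) (.var b)))
      (boolMatrices_induction fun A _ B F _ w => by
        change w a ⊓ ((w a ⊓ w b) ⊔ ((w a)ᶜ ⊓ (w b)ᶜ)) =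
          w b ⊓ ((w a ⊓ w b) ⊔ ((w a)ᶜ ⊓ (w b)ᶜ))
        rw [inf_sup_left, inf_sup_left, ← inf_assoc, ← inf_assoc, inf_compl_self, bot_inf_eq,
          inf_comm (w a)ᶜ, ← inf_assoc (w b), ← inf_assoc (w b), inf_compl_self, bot_inf_eq,
          inf_idem, inf_comm (w b), inf_assoc, inf_idem]) id
    exact (hE a a b).symm.trans (this.trans (hE b a b))
  have h₂ : ∀ x y, M.boolInf x (M.boolIff y y) = x := fun x y => by
    have := logicBAStar_inducedBy.realize_eq hM
      (s := boolInf (.var x) (boolIff (.var y) (.var y))) (t := .var x)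
      (boolMatrices_induction fun A _ B F _ w => by
        change w x ⊓ ((w y ⊓ w y) ⊔ ((w y)ᶜ ⊓ (w y)ᶜ)) = w x
        simp) id
    exact (hE x y y).symm.trans this
  rwa [h, h₂, h₂] at h₁

lemma logicBAStar_hasTheorems : logicBAStar.{u}.HasTheorems :=
  ⟨Functions.apply₁ (L := boolLang.{u}) BoolSymbol.top (.var ⟨0⟩),
    boolMatrices_induction fun _ _ _ _ htop _ _ => htop⟩

/-! ### Logics that are not protoalgebraic -/

/-- Two elements, all operations constant with value `true`, and filter `{true}`. -/
def constMatrix (I : Type u) : LMatrix.{u} (ampleLang I) where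
  carrier := ULift.{u} Bool
  nonempty := ⟨⟨true⟩⟩
  str := { funMap := fun _ _ => ⟨true⟩, RelMap := fun R _ => Empty.elim R }
  filter := {⟨true⟩}

/-- In `constMatrix I` the terms other than variables are constant, so formulas that hold for equal
elements always hold, although the Leibniz congruence is the identity. -/
theorem not_isProtoalgebraic_asrtLogic (I : Type u) : ¬ (asrtLogic I).IsProtoalgebraic := by
  rintro ⟨x, y, Δ, hxy, -, hΔ⟩
  have hM : constMatrix I ∈ Mod (asrtLogic I) := by
    rw [mod_asrtLogic]
    exact ⟨fun _ => rfl, by rintro _ _ rfl rfl; exact .rfl⟩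
  have h := (hΔ (constMatrix I) hM ⟨true⟩ ⟨false⟩).2 fun v _ _ δ hδ => by
    have h := (hΔ (constMatrix I) hM ⟨false⟩ ⟨false⟩).1 .rfl (fun _ => ⟨false⟩) rfl rfl δ hδ
    cases δ with
    | var z => exact absurd (congrArg ULift.down h) Bool.false_ne_true
    | func f ts => rfl
  exact absurd (congrArg ULift.down (h.mem (rfl : (⟨true⟩ : ULift Bool) = ⟨true⟩)))
    Bool.false_ne_true

/-- The four element Boolean algebra with a subset. -/
def fourMatrix (F : Set (Set (ULift.{u} Bool))) : LMatrix.{u} boolLang.{u} where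
  carrier := Set (ULift.{u} Bool)
  nonempty := ⟨∅⟩
  str := boolStructure (Set (ULift.{u} Bool)) inferInstance
  filter := F

/-- Evaluation of terms in the four element Boolean algebra. -/
def fourEval (F : Set (Set (ULift.{u} Bool))) {X : Type*} (v : X → Set (ULift.{u} Bool))
    (t : boolLang.{u}.Term X) : Set (ULift.{u} Bool) :=
  Term.realize (M := (fourMatrix F).carrier) v t

/-- Membership is a homomorphism from a power set to the two element Boolean algebra. -/
lemma mem_fourEval_iff {F G : Set (Set (ULift.{u} Bool))} {X : Type*}
    (t : boolLang.{u}.Term X) {v w : X → Set (ULift.{u} Bool)} {z : ULift.{u} Bool}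
    (h : ∀ i, z ∈ v i ↔ z ∈ w i) : z ∈ fourEval F v t ↔ z ∈ fourEval G w t := by
  induction t with
  | var i => exact h i
  | func f ts ih =>
    cases f with
    | inf => exact and_congr (ih 0) (ih 1)
    | sup => exact or_congr (ih 0) (ih 1)
    | compl => exact not_congr (ih 0)
    | bot => exact Iff.rfl
    | top => exact Iff.rfl

/-- With `{true}` and the top element in place of `x` and `y`, a formula that is a theorem when `x` and
`y` are equal takes values above `{true}`. A filter containing these values need not identify the
two elements. -/
theorem not_isProtoalgebraic_logicBAStar : ¬ logicBAStar.{u}.IsProtoalgebraic := by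
  classical
  rintro ⟨x, y, Δ, hxy, -, hΔ⟩
  have hM : ∀ F : Set (Set (ULift.{u} Bool)), Set.univ ∈ F → fourMatrix F ∈ Mod logicBAStar.{u} :=
    fun F hF => logicBAStar_inducedBy.subset_mod ⟨inferInstanceAs
      (BooleanAlgebra (Set (ULift.{u} Bool))), rfl, hF⟩
  -- all elements of `F` but `∅` contain the atom `{true}`, and only one element is not in `F`
  let F : Set (Set (ULift.{u} Bool)) := {s | ⟨true⟩ ∈ s ∨ s = ∅}
  have h : (fourMatrix F).Leibniz ({⟨true⟩} : Set (ULift.{u} Bool))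
      (Set.univ : Set (ULift.{u} Bool)) := by
    refine (hΔ _ (hM F (.inl trivial)) _ _).2
      fun (v : _ → Set (ULift.{u} Bool)) hx hy δ hδ => .inl ?_
    let w : ULift.{u} ℕ → Set (ULift.{u} Bool) := fun i => if i = x then Set.univ else v i
    have hwx : w x = Set.univ := if_pos rfl
    have hwy : w y = Set.univ := (if_neg hxy.symm).trans hy
    have h₁ : fourEval {Set.univ} w δ = Set.univ :=
      (hΔ _ (hM {Set.univ} rfl) (Set.univ : Set (ULift.{u} Bool))
        (Set.univ : Set (ULift.{u} Bool))).1 .rfl w hwx hwy δ hδ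
    refine (mem_fourEval_iff (F := {Set.univ}) (v := w) δ fun i => ?_).1 
      (Set.eq_univ_iff_forall.1 h₁ _)
    by_cases hi : i = x
    · rw [hi, hwx, show v x = {⟨true⟩} from hx]
      simp
    · rw [show w i = v i from if_neg hi]
  -- the complement of `univ` is in `F` but that of the atom is not
  have hp : (fourMatrix F).IsPoly fun s => Structure.funMap (L := boolLang.{u}) BoolSymbol.compl
      fun _ => s := .func (M := fourMatrix F) BoolSymbol.compl (fun _ s => s) fun _ => .id
  have h₃ : (({⟨true⟩} : Set (ULift.{u} Bool))ᶜ : Set (ULift.{u} Bool)) ∈ F :=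
    (LMatrix.leibniz_iff.1 h _ hp).2 (.inr Set.compl_univ)
  rcases h₃ with h₃ | h₃
  · exact h₃ rfl
  · have : (⟨false⟩ : ULift.{u} Bool) ∈ ({⟨true⟩} : Set (ULift.{u} Bool))ᶜ := by
      simp [ULift.ext_iff]
    rw [h₃] at this
    exact this

/-! ### Suprema of Leibniz classes -/

/-- The pair of logics as a family over the two truth values. -/
abbrev logicPair (l₁ l₂ : Logic.{u}) : Bool → Logic.{u}
  | true => l₁
  | false => l₂

lemma forall_logicPair {l₁ l₂ : Logic.{u}} {p : Logic.{u} → Prop} (h₁ : p l₁) (h₂ : p l₂) :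
    ∀ i, p (logicPair l₁ l₂ i)
  | true => h₁
  | false => h₂

lemma prodLogic_pair_le_left (l₁ l₂ : Logic.{u}) : prodLogic (logicPair l₁ l₂) ≤ l₁ :=
  prodLogic_le (l := logicPair l₁ l₂) true

lemma prodLogic_pair_le_right (l₁ l₂ : Logic.{u}) : prodLogic (logicPair l₁ l₂) ≤ l₂ :=
  prodLogic_le (l := logicPair l₁ l₂) false

/-- The supremum of two Leibniz classes of logics with theorems is determined by the products of
the members of their Leibniz conditions. -/
theorem exists_isLUB {Φ Ψ : Ordinal.{u} → Logic.{u}} (hΦ : IsLeibnizCondition Φ)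
    (hΨ : IsLeibnizCondition Ψ) (hΦ' : ∀ α, (Φ α).HasTheorems) (hΨ' : ∀ α, (Ψ α).HasTheorems)
    {K₁ K₂ : LeibnizClass.{u}} (h₁ : K₁.1 = {l | ∃ α, Φ α ≤ l}) (h₂ : K₂.1 = {l | ∃ α, Ψ α ≤ l}) :
    ∃ K : LeibnizClass.{u}, IsLUB {K₁, K₂} K ∧ K.1 ⊆ Thrms ∧
      K.1 = {l | ∃ α, prodLogic (logicPair (Φ α) (Ψ α)) ≤ l} := by
  have hth : ∀ α i, (logicPair (Φ α) (Ψ α) i).HasTheorems := fun α =>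
    forall_logicPair (hΦ' α) (hΨ' α)
  have hcond : IsLeibnizCondition fun α => prodLogic (logicPair (Φ α) (Ψ α)) := fun α β h =>
    le_prodLogic (hth α) (forall_logicPair
      (Logic.le_trans (prodLogic_pair_le_left _ _) (hΦ α β h))
      (Logic.le_trans (prodLogic_pair_le_right _ _) (hΨ α β h)))
  refine ⟨⟨_, _, hcond, rfl⟩, ⟨?_, ?_⟩, ?_, rfl⟩
  · rintro _ (rfl | rfl) l hl
    · rw [h₁] at hl
      exact hl.imp fun α h => Logic.le_trans (prodLogic_pair_le_left _ _) h
    · rw [h₂] at hl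
      exact hl.imp fun α h => Logic.le_trans (prodLogic_pair_le_right _ _) h
  · rintro ⟨K, Θ, hΘ, rfl⟩ hK l ⟨α, hα⟩
    obtain ⟨β, hβ⟩ : ∃ β, Θ β ≤ Φ α := hK (Set.mem_insert _ _)
      (show Φ α ∈ K₁.1 from h₁ ▸ ⟨α, Logic.le_refl _⟩)
    obtain ⟨γ, hγ⟩ : ∃ γ, Θ γ ≤ Ψ α := hK (Set.mem_insert_of_mem _ rfl)
      (show Ψ α ∈ K₂.1 from h₂ ▸ ⟨α, Logic.le_refl _⟩)
    refine ⟨max β γ, Logic.le_trans (le_prodLogic (hth α) (forall_logicPair ?_ ?_)) hα⟩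
    · exact Logic.le_trans (hΘ _ _ (le_max_left β γ)) hβ
    · exact Logic.le_trans (hΘ _ _ (le_max_right β γ)) hγ
  · rintro l ⟨α, h⟩
    exact (prodLogic_hasTheorems (hth α)).mono h

/-! ### Intersecting the two suprema -/

/-- The symbol of a product of two logics given by a term of each factor. -/
def pairSymbol {l₁ l₂ : Logic.{u}} {n : ℕ} (s : l₁.lang.Term (Fin n)) (t : l₂.lang.Term (Fin n)) :
    ∀ i, (logicPair l₁ l₂ i).lang.Term (Fin n)
  | true => s
  | false => t

/-- `e₁` and `e₂` are the components of a decomposition of `M`, along a translation `σ` of the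
product of `k₁` and `k₂`, into Suszko reduced models `A` and `B` of `k₁` and `k₂`. -/
structure IsPairDecomposition {k₁ k₂ l : Logic.{u}}
    (σ : Translation (prodLogic (logicPair k₁ k₂)).lang l.lang) (M : LMatrix.{u} l.lang)
    (A : LMatrix.{u} k₁.lang) (B : LMatrix.{u} k₂.lang)
    (e₁ : M.carrier → A.carrier) (e₂ : M.carrier → B.carrier) : Prop where
  mem_left : A ∈ ModSuszko k₁
  mem_right : B ∈ ModSuszko k₂
  ext : ∀ x y, e₁ x = e₁ y → e₂ x = e₂ y → x = y
  left : ∀ (s : k₁.lang.Term (Fin 2)) (t : k₂.lang.Term (Fin 2)) (c d : M.carrier),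
    e₁ (Term.realize (M := M.carrier) ![c, d] (σ 2 (pairSymbol s t))) = s.realize ![e₁ c, e₁ d]
  right : ∀ (s : k₁.lang.Term (Fin 2)) (t : k₂.lang.Term (Fin 2)) (c d : M.carrier),
    e₂ (Term.realize (M := M.carrier) ![c, d] (σ 2 (pairSymbol s t))) = t.realize ![e₂ c, e₂ d]
  filter : ∀ x, x ∈ M.filter ↔ e₁ x ∈ A.filter ∧ e₂ x ∈ B.filter
  exists_poly_lift : ∀ p, A.IsPoly p → ∃ q, M.IsPoly q ∧ ∀ x, e₁ (q x) = p (e₁ x)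

lemma IsPairDecomposition.mem_iff {k₁ k₂ l : Logic.{u}}
    {σ : Translation (prodLogic (logicPair k₁ k₂)).lang l.lang} {M : LMatrix.{u} l.lang}
    {A : LMatrix.{u} k₁.lang} {B : LMatrix.{u} k₂.lang} {e₁ : M.carrier → A.carrier}
    {e₂ : M.carrier → B.carrier} (h : IsPairDecomposition σ M A B e₁ e₂)
    (s : k₁.lang.Term (Fin 2)) (t : k₂.lang.Term (Fin 2)) (c d : M.carrier) :
    Term.realize (M := M.carrier) ![c, d] (σ 2 (pairSymbol s t)) ∈ M.filter ↔
      s.realize ![e₁ c, e₁ d] ∈ A.filter ∧ t.realize ![e₂ c, e₂ d] ∈ B.filter := by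
  rw [h.filter, h.left, h.right]

/-- The decomposition theorem for logics that interpret a product. -/
theorem exists_isPairDecomposition {k₁ k₂ l : Logic.{u}} (h₁ : k₁.HasTheorems)
    (h₂ : k₂.HasTheorems) {σ : Translation (prodLogic (logicPair k₁ k₂)).lang l.lang}
    (hσ : IsInterpretation (prodLogic (logicPair k₁ k₂)) l σ) {M : LMatrix.{u} l.lang}
    (hM : M ∈ ModSuszko l) : ∃ A B e₁ e₂, IsPairDecomposition σ M A B e₁ e₂ := by
  obtain ⟨P, e, hd⟩ := exists_decomposition
    (forall_logicPair (p := Logic.HasTheorems) h₁ h₂) (hσ M hM)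
  have hvec : ∀ (i : Bool) (c d : M.carrier),
      (fun k => e ((![c, d] : Fin 2 → M.carrier) k) i) = ![e c i, e d i] := fun i c d => by
    funext k
    fin_cases k <;> rfl
  refine ⟨P true, P false, fun x => e x true, fun x => e x false, hd.mem true, hd.mem false,
    fun x y hx hy => hd.bijective.1 (funext fun i => ?_), fun s t c d => ?_, fun s t c d => ?_,
    fun x => (hd.filter x).trans (by rw [Bool.forall_bool, and_comm]), fun p hp => ?_⟩
  · cases i <;> assumption
  · exact (hd.funMap 2 (pairSymbol s t) ![c, d] true).trans
      (congrArg (fun w => Term.realize (M := (P true).carrier) w s) (hvec true c d))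
  · exact (hd.funMap 2 (pairSymbol s t) ![c, d] false).trans
      (congrArg (fun w => Term.realize (M := (P false).carrier) w t) (hvec false c d))
  · obtain ⟨q, hq, hqp⟩ := hd.exists_poly_lift true hp
    exact ⟨q, hq.of_translate, hqp⟩

/-- The term `x →ᵢ y` for the `i`-th implication of the ample language. -/
def impTerm {I : Type u} (i : I) : (ampleLang I).Term (Fin 2) :=
  Functions.apply₂ (L := ampleLang I) (AmpleSymbol.imp i) (.var 0) (.var 1)

/-- In a decomposed model, the implications of a protoalgebraic component identify the components
of elements. -/
lemma IsPairDecomposition.left_eq {I : Type u} {k l : Logic.{u}}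
    {σ : Translation (prodLogic (logicPair (protoLogic I) k)).lang l.lang} {M : LMatrix.{u} l.lang}
    {A : LMatrix.{u} (ampleLang I)} {B : LMatrix.{u} k.lang}
    {e₁ : M.carrier → A.carrier} {e₂ : M.carrier → B.carrier}
    (h : IsPairDecomposition (k₁ := protoLogic I) σ M A B e₁ e₂) (t : k.lang.Term (Fin 2))
    {a b : M.carrier} (hab : ∀ i p, M.IsPoly p →
      (σ 2 (pairSymbol (l₁ := protoLogic I) (impTerm i) t)).realize ![p a, p b] ∈ M.filter ∧
      (σ 2 (pairSymbol (l₁ := protoLogic I) (impTerm i) t)).realize ![p b, p a] ∈ M.filter) :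
    e₁ a = e₁ b := by
  have himp : ∀ i c d,
      (σ 2 (pairSymbol (l₁ := protoLogic I) (impTerm i) t)).realize ![c, d] ∈ M.filter →
      A.imp i (e₁ c) (e₁ d) ∈ A.filter := fun i c d hcd => by
    have := ((h.mem_iff _ _ _ _).1 hcd).1
    exact (iff_of_eq (congrArg (· ∈ A.filter)
      (realize_imp ![e₁ c, e₁ d] i (.var 0) (.var 1)))).1 this
  refine eq_of_imp h.mem_left fun i p hp => ?_
  obtain ⟨q, hq, hqp⟩ := h.exists_poly_lift p hp
  rw [← hqp, ← hqp]
  exact ⟨himp i _ _ (hab i q hq).1, himp i _ _ (hab i q hq).2⟩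

/-- A logic is protoalgebraic as soon as it interprets a product of a protoalgebraic logic with an
assertional one, and also a product of a protoalgebraic logic with `⊢*_BA`. -/
theorem isProtoalgebraic_of_prodLogic_le {I J : Type u} [Nonempty I] [Nonempty J] {l : Logic.{u}}
    (h₁ : prodLogic (logicPair (protoLogic I) (asrtLogic I)) ≤ l)
    (h₂ : prodLogic (logicPair (protoLogic J) logicBAStar) ≤ l) : l.IsProtoalgebraic := by
  obtain ⟨τ, hτ⟩ := h₁
  obtain ⟨σ, hσ⟩ := h₂
  let topTerm : (ampleLang I).Term (Fin 2) :=
    Functions.apply₁ (L := ampleLang I) AmpleSymbol.top (.var 0)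
  let s₁ : I → l.lang.Term (Fin 2) := fun i =>
    τ 2 (pairSymbol (l₁ := protoLogic I) (l₂ := asrtLogic I) (impTerm i) topTerm)
  let s₂ : J → l.lang.Term (Fin 2) := fun j =>
    σ 2 (pairSymbol (l₁ := protoLogic J) (l₂ := logicBAStar) (impTerm j)
      (boolIff (.var 0) (.var 0)))
  let j₀ : J := Classical.arbitrary J
  let s₃ : l.lang.Term (Fin 2) :=
    σ 2 (pairSymbol (l₁ := protoLogic J) (l₂ := logicBAStar)
      (Functions.apply₂ (L := ampleLang J) (AmpleSymbol.imp j₀) (.var 0) (.var 0))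
      (boolIff (.var 0) (.var 1)))
  have hdec₁ : ∀ M ∈ ModSuszko l, ∃ (A : LMatrix.{u} (ampleLang I)) (B : LMatrix.{u} (ampleLang I))
      (e₁ : M.carrier → A.carrier) (e₂ : M.carrier → B.carrier),
      IsPairDecomposition (k₁ := protoLogic I) (k₂ := asrtLogic I) τ M A B e₁ e₂ := fun M hM =>
    exists_isPairDecomposition protoLogic_hasTheorems asrtLogic_hasTheorems hτ hM
  have hdec₂ : ∀ M ∈ ModSuszko l, ∃ (A : LMatrix.{u} (ampleLang J)) (B : LMatrix.{u} boolLang.{u})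
      (e₁ : M.carrier → A.carrier) (e₂ : M.carrier → B.carrier),
      IsPairDecomposition (k₁ := protoLogic J) (k₂ := logicBAStar) σ M A B e₁ e₂ := fun M hM =>
    exists_isPairDecomposition protoLogic_hasTheorems logicBAStar_hasTheorems hσ hM
  have hrefl : ∀ M ∈ ModSuszko l, ∀ a, ∀ δ ∈ insert s₃ (Set.range s₁ ∪ Set.range s₂),
      δ.realize ![a, a] ∈ M.filter := by
    intro M hM a δ hδ
    obtain ⟨A, B, e₁, e₂, hd⟩ := hdec₁ M hM
    obtain ⟨A', B', f₁, f₂, hd'⟩ := hdec₂ M hM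
    have hA : A ∈ protoMatrices I := mod_protoLogic (I := I) ▸ hd.mem_left.1
    have hB : B ∈ asrtMatrices I := mod_asrtLogic (I := I) ▸ hd.mem_right.1
    have hA' : A' ∈ protoMatrices J := mod_protoLogic (I := J) ▸ hd'.mem_left.1
    rcases hδ with rfl | ⟨i, rfl⟩ | ⟨j, rfl⟩
    · refine (hd'.mem_iff _ _ a a).2 ⟨?_, ?_⟩
      · exact (iff_of_eq (congrArg (· ∈ A'.filter)
          (realize_imp ![f₁ a, f₁ a] j₀ (.var 0) (.var 0)))).2 (hA'.1 _ _)
      · exact (iff_of_eq (congrArg (· ∈ B'.filter)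
          (realize_boolIff ![f₂ a, f₂ a] (.var 0) (.var 1)))).2 (boolIff_self_mem hd'.mem_right.1 _)
    · refine (hd.mem_iff _ _ a a).2 ⟨?_, ?_⟩
      · exact (iff_of_eq (congrArg (· ∈ A.filter)
          (realize_imp ![e₁ a, e₁ a] i (.var 0) (.var 1)))).2 (hA.1 _ _)
      · have key : Term.realize (M := B.carrier) ![e₂ a, e₂ a] topTerm = B.top (e₂ a) :=
          Term.realize_functions_apply₁
        exact (iff_of_eq (congrArg (· ∈ B.filter) key)).2 (hB.1 (e₂ a))
    · refine (hd'.mem_iff _ _ a a).2 ⟨?_, ?_⟩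
      · exact (iff_of_eq (congrArg (· ∈ A'.filter)
          (realize_imp ![f₁ a, f₁ a] j (.var 0) (.var 1)))).2 (hA'.1 _ _)
      · exact (iff_of_eq (congrArg (· ∈ B'.filter)
          (realize_boolIff ![f₂ a, f₂ a] (.var 0) (.var 0)))).2 (boolIff_self_mem hd'.mem_right.1 _)
  refine isProtoalgebraic_of_separating (insert s₃ (Set.range s₁ ∪ Set.range s₂))
    (Set.insert_nonempty _ _) hrefl fun M hM a b hab => ?_
  obtain ⟨A, B, e₁, e₂, hd⟩ := hdec₁ M hM
  obtain ⟨A', B', f₁, f₂, hd'⟩ := hdec₂ M hM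
  have hf₁ : f₁ a = f₁ b := hd'.left_eq _ fun j p hp => hab _ (.inr (.inr ⟨j, rfl⟩)) p hp
  -- the polynomial `q(x)` with a theorem as first component and `a ↔ x` as second component
  let q : M.carrier → M.carrier := fun x => s₃.realize ![a, x]
  have hq : M.IsPoly q := by
    have := LMatrix.IsPoly.term s₃ ![fun _ : M.carrier => a, fun x => x] (by
      intro i
      fin_cases i
      · exact .const a
      · exact .id)
    convert this using 3 with x
    funext i
    fin_cases i <;> rfl
  have hqa : q a ∈ M.filter := hrefl M hM a s₃ (.inl rfl)
  have hqb : q b ∈ M.filter := (hab s₃ (.inl rfl) _ .id).1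
  -- both values of `q` lie in the filter, whose assertional component is a singleton
  have hqab : q a = q b := by
    refine hd.ext _ _ (hd.left_eq topTerm fun i p hp =>
      hab _ (.inr (.inl ⟨i, rfl⟩)) _ (hp.comp hq)) ?_
    obtain ⟨c, hc⟩ :=
      Logic.IsAssertional.of_asrtLogic_le (Logic.le_refl (asrtLogic I)) B hd.mem_right
    have ha := ((hd.filter _).1 hqa).2
    have hb := ((hd.filter _).1 hqb).2
    rw [hc] at ha hb
    exact Eq.trans ha (Eq.symm hb)
  have hiff : ∀ x, f₂ (q x) = B'.boolIff (f₂ a) (f₂ x) := fun x =>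
    (hd'.right _ _ a x).trans (realize_boolIff ![f₂ a, f₂ x] (.var 0) (.var 1))
  refine hd'.ext a b hf₁ (eq_of_boolIff_eq hd'.mem_right ?_)
  rw [← hiff, ← hiff, hqab]

lemma isLeibnizClass_logOf (l : Logic.{u}) : IsLeibnizClass (logOf l) :=
  ⟨fun _ => l, fun _ _ _ => l.le_refl, by simp [logOf]⟩

end LeibnizHierarchy

open LeibnizHierarchy in
theorem theorem6p4 :
    ∃ (hP : IsLeibnizClass Proto.{u}) (hA : IsLeibnizClass Asrt.{u})
      (hB : IsLeibnizClass (logOf logicBAStar.{u})),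
      MeetReducibleAmongTheorems ⟨Proto, hP⟩ ∧
      ∃ K₁ K₂ : LeibnizClass.{u},
        IsLUB {⟨Proto, hP⟩, ⟨Asrt, hA⟩} K₁ ∧
        IsLUB {⟨Proto, hP⟩, ⟨logOf logicBAStar, hB⟩} K₂ ∧
        Proto = K₁.1 ∩ K₂.1 ∧
        Proto ⊂ K₁.1 ∧ Proto ⊂ K₂.1 ∧
        K₁.1 ⊆ Thrms ∧ K₂.1 ⊆ Thrms := by
  have hPeq : Proto.{u} = {l | ∃ α, protoLogic (ampleIndex α) ≤ l} :=
    Set.ext fun l => isProtoalgebraic_iff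
  have hAeq : Asrt.{u} = {l | ∃ α, asrtLogic (ampleIndex α) ≤ l} :=
    Set.ext fun l => isAssertional_iff
  have hBeq : logOf logicBAStar.{u} = {l | ∃ _ : Ordinal.{u}, logicBAStar ≤ l} := by
    simp [logOf]
  have hP : IsLeibnizClass Proto.{u} := ⟨_, isLeibnizCondition_protoLogic, hPeq⟩
  have hA : IsLeibnizClass Asrt.{u} := ⟨_, isLeibnizCondition_asrtLogic, hAeq⟩
  have hB : IsLeibnizClass (logOf logicBAStar.{u}) := isLeibnizClass_logOf _
  obtain ⟨K₁, hlub₁, hth₁, hK₁⟩ := exists_isLUB isLeibnizCondition_protoLogic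
    isLeibnizCondition_asrtLogic (fun _ => protoLogic_hasTheorems) (fun _ => asrtLogic_hasTheorems)
    (K₁ := ⟨Proto, hP⟩) (K₂ := ⟨Asrt, hA⟩) hPeq hAeq
  obtain ⟨K₂, hlub₂, hth₂, hK₂⟩ := exists_isLUB isLeibnizCondition_protoLogic
    (Ψ := fun _ => logicBAStar) (fun _ _ _ => Logic.le_refl _) (fun _ => protoLogic_hasTheorems)
    (fun _ => logicBAStar_hasTheorems)
    (K₁ := ⟨Proto, hP⟩) (K₂ := ⟨logOf logicBAStar, hB⟩) hPeq hBeq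
  have hsub₁ : Proto ⊆ K₁.1 := hlub₁.1 (Set.mem_insert _ _)
  have hsub₂ : Proto ⊆ K₂.1 := hlub₂.1 (Set.mem_insert _ _)
  have hinter : Proto = K₁.1 ∩ K₂.1 := by
    refine Set.Subset.antisymm (Set.subset_inter hsub₁ hsub₂) ?_
    rintro l ⟨h₁, h₂⟩
    rw [hK₁] at h₁
    rw [hK₂] at h₂
    obtain ⟨α, hα⟩ := h₁
    obtain ⟨β, hβ⟩ := h₂
    exact isProtoalgebraic_of_prodLogic_le hα hβ
  have hss₁ : Proto ⊂ K₁.1 := hsub₁.ssubset_of_ne fun h =>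
    not_isProtoalgebraic_asrtLogic (ampleIndex 0) <| by
      have : asrtLogic (ampleIndex 0) ∈ K₁.1 :=
        hlub₁.1 (Set.mem_insert_of_mem _ rfl) 
          (show (asrtLogic (ampleIndex 0)).IsAssertional from
            isAssertional_iff.2 ⟨0, Logic.le_refl _⟩)
      rwa [← h] at this
  have hss₂ : Proto ⊂ K₂.1 := hsub₂.ssubset_of_ne fun h =>
    not_isProtoalgebraic_logicBAStar <| by
      have : logicBAStar ∈ K₂.1 := hlub₂.1 (Set.mem_insert_of_mem _ rfl) (Logic.le_refl _)
      rwa [← h] at this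
  exact ⟨hP, hA, hB,
    ⟨K₁, K₂, hth₁, hth₂, hinter, fun h => hss₁.ne (congrArg Subtype.val h),
      fun h => hss₂.ne (congrArg Subtype.val h)⟩,
    K₁, K₂, hlub₁, hlub₂, hinter, hss₁, hss₂, hth₁, hth₂⟩
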